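/- **Notation.** $\mathbb N$ is the set of positive integers and $[n]=\{1,\dots,n\}$; $[n]_p$ is the random subset of $[n]$ containing each element independently with probability $p\in[0,1]$. A system of linear equations $A$ is of the form $A'x=b$ with $A'$ an integer $\ell_A\times k_A$ matrix (its *underlying matrix*) and $b\in\mathbb Z^{\ell_A}$. A *distinct solution* to $A$ in a set $S\subseteq\mathbb Z$ is a solution $x\in S^{k_A}$ with pairwise distinct coordinates. A system is *irredundant* if it has a distinct solution in $\mathbb N$; a matrix $M$ is irredundant if $Mx=0$ is. A matrix has *full rank* if its rank equals its number of rows; a system has full rank if its underlying matrix does. A matrix $M$ is *partition regular* if every finite colouring of $\mathbb N$ has a monochromatic solution to $Mx=0$ in $\mathbb N$. A set $S\subseteq\mathbb Z$ is *$(A_1,\dots,A_r)$-Rado* if for every colouring of $S$ with colours $1,\dots,r$ there are $i$ and a distinct solution to $A_i$ in $S$ all of whose coordinates have colour $i$; if all $A_i$ equal $A$ we say *$(A,r)$-Rado* (a matrix $M$ being identified with the system $Mx=0$). For an integer matrix $M$ with columns indexed by $[k]$ and $V\subseteq[k]$, let $M_V$ be the matrix formed by the columns in $V$ (of rank $0$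 if $V=\emptyset$), and $\overline W=[k]\setminus W$. Put $$m(M)=\max_{W\subseteq[k],\,|W|\ge2}\frac{|W|-1}{|W|-1+\operatorname{rank}(M_{\overline W})-\operatorname{rank}(M)},$$ $$m(M,N)=\max_{W\subseteq[k],\,|W|\ge2}\frac{|W|}{|W|-1+\operatorname{rank}(M_{\overline W})-\operatorname{rank}(M)+1/m(N)},$$ and for systems $m(A,B)=m(A',B')$ with $A',B'$ the underlying matrices. An $\ell\times k$ matrix $M$ of full rank is *strictly balanced* if $\frac{|W|-1}{|W|-1+\operatorname{rank}(M_{\overline W})-\ell}<\frac{k-1}{k-1-\ell}$ for all $W\subseteq[k]$ with $2\le|W|<k$. A *core* of an irredundant partition regular matrix $M$ is an integer matrix $C$, irredundant, of full rank and strictly balanced, with $m(C)=m(M)$, that is obtained from $M$ by rational row operations, deletion of rows, and then deletion of columns that are zero in all remaining rows. **Theorem.** (a) Let $k,\ell$ be positive integers with $k\ge\ell+2$. There is a constant $c>0$, depending only on $k$ and $\ell$, such that the following holds. Let $A$ and $B$ be systems of linear equations such that $A$, $B$ and their underlying matrices are irredundant and of full rank, the underlying matrices are partition regular, and each underlying matrix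 has a core of dimension $\ell\times k$. Then $\frac1{m(A,B)}=\frac{k-\ell-1}{k-1}$, and if $p=p(n)\le c\,n^{-1/m(A,B)}=c\,n^{-\frac{k-\ell-1}{k-1}}$ (for all large $n$), then $$\lim_{n\to\infty}\mathbb P\big[[n]_p\text{ is }(A,B)\text{-Rado}\big]=0.$$ (b) In particular (the $0$-statement of the random Rado theorem of Rödl and Ruciński): for every irredundant partition regular integer matrix $A$ of full rank with at least one row, and every integer $r\ge2$, there is a constant $c>0$ such that if $p=p(n)<c\,n^{-1/m(A)}$ (for all large $n$), then $$\lim_{n\to\infty}\mathbb P\big[[n]_p\text{ is }(A,r)\text{-Rado}\big]=0.$$ -/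

import Mathlib

open Matrix Filter Topology MeasureTheory ProbabilityTheory unitInterval

noncomputable section

namespace RandomRado

/-- A finite system of linear equations `mat * x = rhs` with integer coefficients, in `cols`
variables; `mat` is its underlying matrix. -/
structure LinearSystem where
  rows : ℕ
  cols : ℕ
  mat : Matrix (Fin rows) (Fin cols) ℤ
  rhs : Fin rows → ℤ

/-- `x` is a `k`-distinct solution to `A x = b` in `S`: a solution with pairwise distinct
coordinates, all of them in `S`. -/
def IsDistinctSolution {ℓ k : ℕ} (A : Matrix (Fin ℓ) (Fin k) ℤ) (b : Fin ℓ → ℤ) (S : Set ℤ)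
    (x : Fin k → ℤ) : Prop :=
  Function.Injective x ∧ (∀ j, x j ∈ S) ∧ A *ᵥ x = b

/-- `A x = b` is irredundant: it has a `k`-distinct solution in the positive integers.
A matrix `A` is irredundant if this holds with `b = 0`. -/
def Irredundant {ℓ k : ℕ} (A : Matrix (Fin ℓ) (Fin k) ℤ) (b : Fin ℓ → ℤ) : Prop :=
  ∃ x, IsDistinctSolution A b {z | 0 < z} x

/-- Every finite colouring of the positive integers has a monochromatic solution to `A x = 0`
(not necessarily with distinct coordinates). -/
def PartitionRegular {ℓ k : ℕ} (A : Matrix (Fin ℓ) (Fin k) ℤ) : Prop :=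
  ∀ (r : ℕ) (χ : ℤ → Fin r), ∃ (c : Fin r) (x : Fin k → ℤ),
    (∀ j, 0 < x j ∧ χ (x j) = c) ∧ A *ᵥ x = 0

/-- The rank (over `ℚ`) of the matrix formed by the columns of `A` indexed by `V`. -/
def colRank {ℓ k : ℕ} (A : Matrix (Fin ℓ) (Fin k) ℤ) (V : Finset (Fin k)) : ℕ :=
  ((A.map (Int.cast : ℤ → ℚ)).submatrix id (Subtype.val : {j // j ∈ V} → Fin k)).rank

/-- The rank of `A` equals its number of rows. -/
def FullRank {ℓ k : ℕ} (A : Matrix (Fin ℓ) (Fin k) ℤ) : Prop :=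
  colRank A Finset.univ = ℓ

/-- `m(A)`, the maximum over `W ⊆ [k]` with `|W| ≥ 2` of
`(|W| - 1) / (|W| - 1 + rank A_{[k] ∖ W} - rank A)`. All denominators are positive when `A` is
irredundant and partition regular. -/
def mParam {ℓ k : ℕ} (A : Matrix (Fin ℓ) (Fin k) ℤ) : ℝ :=
  ⨆ W : {W : Finset (Fin k) // 2 ≤ W.card},
    ((W.1.card : ℝ) - 1) /
      ((W.1.card : ℝ) - 1 + (colRank A (W.1)ᶜ : ℝ) - (colRank A Finset.univ : ℝ))

/-- `m(A, B)`, the maximum over `W ⊆ [k_A]` with `|W| ≥ 2` of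
`|W| / (|W| - 1 + rank A_{[k_A] ∖ W} - rank A + 1 / m(B))`. -/
def mPair {ℓA kA ℓB kB : ℕ} (A : Matrix (Fin ℓA) (Fin kA) ℤ) (B : Matrix (Fin ℓB) (Fin kB) ℤ) :
    ℝ :=
  ⨆ W : {W : Finset (Fin kA) // 2 ≤ W.card},
    (W.1.card : ℝ) /
      ((W.1.card : ℝ) - 1 + (colRank A (W.1)ᶜ : ℝ) - (colRank A Finset.univ : ℝ) + 1 / mParam B)

/-- An `ℓ × k` matrix of full rank is strictly balanced if `W = [k]` is the unique maximiser in
the definition of `m`. -/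
def StrictlyBalanced {ℓ k : ℕ} (A : Matrix (Fin ℓ) (Fin k) ℤ) : Prop :=
  ∀ W : Finset (Fin k), 2 ≤ W.card → W.card < k →
    ((W.card : ℝ) - 1) / ((W.card : ℝ) - 1 + (colRank A Wᶜ : ℝ) - (ℓ : ℝ))
      < ((k : ℝ) - 1) / ((k : ℝ) - 1 - (ℓ : ℝ))

/-- `C` is a core of `A`. It is obtained from `A` by (rational) row operations followed by deleting
rows, and then deleting columns that vanish on the remaining rows: the rows of `C`, extended by `0`
to the deleted columns, are the rows of `P * A`. Hence every solution to `A x = 0` contains a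
solution to `C y = 0` as an ordered subvector. Moreover `m(C) = m(A)`, and `C` is irredundant, of
full rank and strictly balanced. -/
structure IsCore {ℓA kA ℓ k : ℕ} (A : Matrix (Fin ℓA) (Fin kA) ℤ)
    (C : Matrix (Fin ℓ) (Fin k) ℤ) : Prop where
  obtained : ∃ (e : Fin k ↪o Fin kA) (P : Matrix (Fin ℓ) (Fin ℓA) ℚ),
    (∀ i j, (P * A.map (Int.cast : ℤ → ℚ)) i (e j) = (C i j : ℚ)) ∧
    (∀ i, ∀ j ∉ Set.range e, (P * A.map (Int.cast : ℤ → ℚ)) i j = 0)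
  mParam_eq : mParam C = mParam A
  irredundant : Irredundant C 0
  fullRank : FullRank C
  strictlyBalanced : StrictlyBalanced C

/-- `S` is `(A_1, …, A_r)`-Rado: for every `r`-colouring there are a colour `i` and a distinct
solution in `S` to the `i`-th system all of whose coordinates have colour `i`. (Only the colours of
the elements of `S` matter.) -/
def IsRado {r : ℕ} (A : Fin r → LinearSystem) (S : Set ℤ) : Prop :=
  ∀ χ : ℤ → Fin r, ∃ i, ∃ x, IsDistinctSolution (A i).mat (A i).rhs S x ∧ ∀ j, χ (x j) = i

/-- The probability that the binomial random set `[n]_p` is `(A_1, …, A_r)`-Rado. -/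
def radoProb {r : ℕ} (A : Fin r → LinearSystem) (n : ℕ) (p : I) : ℝ :=
  (setBernoulli (Set.Icc (1 : ℤ) (n : ℤ)) p).real {S | IsRado A S}

end RandomRado

end

/-!
If `[n]_p` is Rado, then its distinct solutions contain a minimal family without a proper
two-colouring. Minimality provides, for every vertex of every edge, another edge meeting it in that
vertex only. Exploring such a hypergraph edge by edge, each new edge normally meets the old ones in
a single vertex; either this lasts for a path of about `log n` edges, or some step has exactly two
old vertices and a further step is again denser than a path step.

Let `θ = (k - ℓ - 1) / (k - 1)` and `p ≤ c * n ^ (-θ)`. Partition regularity makes the projection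
of the solution space to any two coordinates two-dimensional, and strict balancedness bounds the
dimension of the projections to more coordinates. In the expected number of such configurations
the first edge therefore contributes `n ^ (1 - θ)` and, for small `c`, every path step a factor
`1 / 2`; the step with two old vertices cancels `n ^ (1 - θ)` and the further dense step gains some
`n ^ (-ε)`, so the expectation tends to `0`.

The difference of two solutions to a system restricts to a homogeneous solution to its core, which
reduces (a) to strictly balanced matrices; in (b) the coordinates in a smallest maximiser `W` of
`m(A)` play the part of the core.
-/

noncomputable section

namespace RandomRado

open Module

/-! ### Critical hypergraphs -/

section Hypergraph

variable {α : Type*}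

/-- `F` is a family of edges with assigned colours such that every two-colouring of the vertices
makes some edge monochromatic in its assigned colour. -/
def ForcesMonochromatic (F : Finset (Fin 2 × Finset α)) : Prop :=
  ∀ χ : α → Fin 2, ∃ x ∈ F, ∀ v ∈ x.2, χ v = x.1

variable {F : Finset (Fin 2 × Finset α)}

lemma exists_colouring_of_minimal (hF : Minimal ForcesMonochromatic F) {x : Fin 2 × Finset α}
    (hx : x ∈ F) :
    ∃ χ : α → Fin 2, (∀ v ∈ x.2, χ v = x.1) ∧ ∀ y ∈ F, (∀ v ∈ y.2, χ v = y.1) → y = x := by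
  classical
  have herase := hF.not_prop_of_lt (Finset.erase_ssubset hx)
  simp only [ForcesMonochromatic, not_forall, not_exists, not_and] at herase
  obtain ⟨χ, hχ⟩ := herase
  have honly : ∀ y ∈ F, (∀ v ∈ y.2, χ v = y.1) → y = x := fun y hy hyχ => by
    by_contra hne
    obtain ⟨v, hv, hvχ⟩ := hχ y (Finset.mem_erase.2 ⟨hne, hy⟩)
    exact hvχ (hyχ v hv)
  obtain ⟨y, hy, hyχ⟩ := hF.prop χ
  exact ⟨χ, honly y hy hyχ ▸ hyχ, honly⟩

lemma exists_monochromatic_of_minimal (hF : Minimal ForcesMonochromatic F) {U : Finset α}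
    (hU : ∀ x ∈ F, x.2 ⊆ U ∨ Disjoint x.2 U) {x : Fin 2 × Finset α} (hx : x ∈ F)
    (hxne : x.2.Nonempty) (hxU : x.2 ⊆ U) (R : Finset α) :
    ∃ y ∈ F, y.2 ⊆ U ∧ (y.2 ⊆ R ∨ Disjoint y.2 R) := by
  classical
  obtain ⟨χ, -, honly⟩ := exists_colouring_of_minimal hF hx
  obtain ⟨y, hy, hyχ⟩ := hF.prop fun w => if w ∈ U then (if w ∈ R then 0 else 1) else χ w
  have hyU : y.2 ⊆ U := (hU y hy).resolve_right fun hdisj => by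
    obtain rfl : y = x := honly y hy fun w hw => by
      rw [← hyχ w hw, if_neg (Finset.disjoint_left.1 hdisj hw)]
    obtain ⟨v, hv⟩ := hxne
    exact Finset.disjoint_left.1 hdisj hv (hxU hv)
  have hyR : ∀ w ∈ y.2, (if w ∈ R then (0 : Fin 2) else 1) = y.1 := fun w hw => by
    rw [← hyχ w hw, if_pos (hyU hw)]
  refine ⟨y, hy, hyU, ?_⟩
  by_cases hy0 : y.1 = 0
  · exact .inl fun w hw => by simpa [hy0] using hyR w hw
  · exact .inr (Finset.disjoint_left.2 fun w hw hwR => hy0 (by simpa [hwR] using (hyR w hw).symm))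

variable [DecidableEq α]

lemma exists_inter_eq_singleton_of_minimal (hF : Minimal ForcesMonochromatic F) {i : Fin 2}
    {e : Finset α} (he : (i, e) ∈ F) {v : α} (hv : v ∈ e) :
    ∃ i' f, (i', f) ∈ F ∧ f ∩ e = {v} := by
  obtain ⟨χ, hχ, honly⟩ := exists_colouring_of_minimal hF he
  obtain ⟨⟨i', f⟩, hf, hfχ⟩ := hF.prop (Function.update χ v (i + 1))
  dsimp only at hχ hfχ
  have hvf : v ∈ f := by
    by_contra hvf
    have hfe : (i', f) = (i, e) := honly _ hf fun w hw => by
      rw [← hfχ w hw, Function.update_of_ne (ne_of_mem_of_not_mem hw hvf)]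
    exact hvf ((Prod.mk.injEq .. ▸ hfe).2 ▸ hv)
  have hi' : i' = i + 1 := by simpa using (hfχ v hvf).symm
  refine ⟨i', f, hf, Finset.eq_singleton_iff_unique_mem.2 ⟨Finset.mem_inter.2 ⟨hvf, hv⟩, ?_⟩⟩
  intro w hw
  obtain ⟨hwf, hwe⟩ := Finset.mem_inter.1 hw
  by_contra hwv
  have hiw := hfχ w hwf
  rw [Function.update_of_ne hwv, hχ w hwe, hi'] at hiw
  exact absurd hiw (by fin_cases i <;> decide)

/-- A `k`-uniform hypergraph with edge set `E` as it arises from a minimal family of edges that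
cannot be avoided by a two-colouring: every vertex of an edge `e` is the only common vertex of `e`
and some edge, and no nonempty union of components (with vertex set `U`) has a proper
two-colouring (with colour classes `R` and its complement). -/
structure Critical (E : Set (Finset α)) (k : ℕ) : Prop where
  nonempty : E.Nonempty
  uniform : ∀ e ∈ E, e.card = k
  exists_inter_eq_singleton : ∀ e ∈ E, ∀ v ∈ e, ∃ f ∈ E, f ∩ e = {v}
  exists_monochromatic : ∀ U : Finset α, (∀ e ∈ E, e ⊆ U ∨ Disjoint e U) → (∃ e ∈ E, e ⊆ U) →
    ∀ R : Finset α, ∃ e ∈ E, e ⊆ U ∧ (e ⊆ R ∨ Disjoint e R)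

lemma ForcesMonochromatic.exists_critical {k : ℕ} (hk : 1 ≤ k) (hF : ForcesMonochromatic F)
    (hu : ∀ x ∈ F, x.2.card = k) :
    ∃ E : Set (Finset α), (∀ e ∈ E, ∃ i, (i, e) ∈ F) ∧ Critical E k := by
  obtain ⟨F', hle, hmin⟩ := exists_minimal_le_of_wellFoundedLT ForcesMonochromatic F hF
  refine ⟨{e | ∃ i, (i, e) ∈ F'}, fun e ⟨i, hi⟩ => ⟨i, hle hi⟩, ?_, ?_, ?_, ?_⟩
  · obtain ⟨x, hx, -⟩ := hmin.prop fun _ => 0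
    exact ⟨x.2, x.1, hx⟩
  · rintro e ⟨i, hi⟩
    exact hu _ (hle hi)
  · rintro e ⟨i, hi⟩ v hv
    obtain ⟨i', f, hf, hfe⟩ := exists_inter_eq_singleton_of_minimal hmin hi hv
    exact ⟨f, ⟨i', hf⟩, hfe⟩
  · rintro U hU ⟨e, ⟨i, hi⟩, heU⟩ R
    have hene : e.Nonempty := Finset.card_pos.1 (hk.trans_eq (hu _ (hle hi)).symm)
    obtain ⟨y, hy, hyU, hyR⟩ := exists_monochromatic_of_minimal hmin
      (fun x hx => hU x.2 ⟨x.1, hx⟩) hi hene heU R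
    exact ⟨y.2, ⟨y.1, hy⟩, hyU, hyR⟩

/-! ### Connected edge sequences -/

/-- `Grow E k j a b l U e` holds if there is a sequence of `l + 1` edges of `E` with union `U` and
last edge `e` in which every edge meets the union of its predecessors. Apart from `j` exceptional
steps each edge meets that union in one vertex, which lies in the preceding edge. Among the
exceptional steps, `a` meet it in exactly two vertices and `b` further ones in at least two but
not all vertices. The expected number of such sequences in a random set is then bounded by charging
a factor of order `l` to each exceptional step and a negative power of `n` to the `a + b` steps. -/
inductive Grow (E : Set (Finset α)) (k : ℕ) : ℕ → ℕ → ℕ → ℕ → Finset α → Finset α → Prop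
  | start {e : Finset α} (he : e ∈ E) : Grow E k 0 0 0 0 e e
  | run {j a b l : ℕ} {U e f : Finset α} (h : Grow E k j a b l U e) (hf : f ∈ E)
      (hc : (f ∩ U).card = 1) (hm : (f ∩ e).Nonempty) : Grow E k j a b (l + 1) (U ∪ f) f
  | jump {j a b l : ℕ} {U e f : Finset α} (h : Grow E k j a b l U e) (hf : f ∈ E)
      (hc : (f ∩ U).card = 1) : Grow E k (j + 1) a b (l + 1) (U ∪ f) f
  | two {j a b l : ℕ} {U e f : Finset α} (h : Grow E k j a b l U e) (hf : f ∈ E)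
      (hc : (f ∩ U).card = 2) : Grow E k (j + 1) (a + 1) b (l + 1) (U ∪ f) f
  | gain {j a b l : ℕ} {U e f : Finset α} (h : Grow E k j a b l U e) (hf : f ∈ E)
      (hc : 2 ≤ (f ∩ U).card) (hc' : (f ∩ U).card < k) :
      Grow E k (j + 1) a (b + 1) (l + 1) (U ∪ f) f

variable {E : Set (Finset α)} {k j a b l t T : ℕ} {U V e f q : Finset α} {v : α}

lemma Grow.union_induction {motive : Finset α → Prop} (start : ∀ e ∈ E, motive e)
    (step : ∀ U, ∀ f ∈ E, (f ∩ U).Nonempty → motive U → motive (U ∪ f))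
    (h : Grow E k j a b l U e) : motive U := by
  induction h with
  | start he => exact start _ he
  | run _ hf hc _ ih => exact step _ _ hf (Finset.card_pos.1 (by omega)) ih
  | jump _ hf hc ih => exact step _ _ hf (Finset.card_pos.1 (by omega)) ih
  | two _ hf hc ih => exact step _ _ hf (Finset.card_pos.1 (by omega)) ih
  | gain _ hf hc _ ih => exact step _ _ hf (Finset.card_pos.1 (by omega)) ih

lemma Grow.mono {E' : Set (Finset α)} (h : Grow E k j a b l U e) (hE : E ⊆ E') :
    Grow E' k j a b l U e := by
  induction h with
  | start he => exact .start (hE he)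
  | run _ hf hc hm ih => exact ih.run (hE hf) hc hm
  | jump _ hf hc ih => exact ih.jump (hE hf) hc
  | two _ hf hc ih => exact ih.two (hE hf) hc
  | gain _ hf hc hc' ih => exact ih.gain (hE hf) hc hc'

lemma Grow.card_add_eq (hu : ∀ e ∈ E, e.card = k + 1) (h : Grow E (k + 1) j a b l U e)
    (hb : b = 0) : U.card + a = k + 1 + l * k := by
  have hunion (U f : Finset α) (hf : f ∈ E) : (U ∪ f).card + (f ∩ U).card = U.card + (k + 1) := by
    rw [← hu f hf, Finset.inter_comm, Finset.card_union_add_card_inter]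
  induction h with
  | start he => simp [hu _ he]
  | run | jump | two => grind
  | gain => omega

lemma Grow.subset_or_disjoint (hV : ∀ e ∈ E, e ⊆ V ∨ Disjoint e V) (h : Grow E k j a b l U e) :
    U ⊆ V ∨ Disjoint U V := by
  refine h.union_induction (motive := fun U => U ⊆ V ∨ Disjoint U V) hV ?_
  rintro U f hf ⟨x, hx⟩ hU
  obtain ⟨hxf, hxU⟩ := Finset.mem_inter.1 hx
  rcases hV f hf with hfV | hfV <;> rcases hU with hU | hU
  · exact .inl (Finset.union_subset hU hfV)
  · exact absurd (hfV hxf) (Finset.disjoint_left.1 hU hxU)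
  · exact absurd (hU hxU) (Finset.disjoint_left.1 hfV hxf)
  · exact .inr (Finset.disjoint_union_left.2 ⟨hU, hfV⟩)

/-- `PathFrom E U e t V f` says that there are `t + 1` edges, the first being `e` and the last `f`,
such that each but the first meets its predecessor in one vertex and is disjoint from `U` and all
earlier edges. Here `V` is the union of `U` and all of the edges except `f`. -/
inductive PathFrom (E : Set (Finset α)) (U e : Finset α) : ℕ → Finset α → Finset α → Prop
  | start : PathFrom E U e 0 U e
  | step {t : ℕ} {V f g : Finset α} (h : PathFrom E U e t V f) (hg : g ∈ E)
      (hc : (g ∩ f).card = 1) (hd : Disjoint g V) : PathFrom E U e (t + 1) (V ∪ f) g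

lemma inter_union_eq_of_disjoint {s t u : Finset α} (h : Disjoint s t) :
    s ∩ (t ∪ u) = s ∩ u := by
  rw [Finset.inter_union_distrib_left, Finset.disjoint_iff_inter_eq_empty.1 h, Finset.empty_union]

namespace PathFrom

lemma mem (h : PathFrom E U e t V f) (he : e ∈ E) : f ∈ E := by
  cases h <;> assumption

lemma card_inter (h : PathFrom E U e t V f) (heU : t = 0 → (e ∩ U).card = 1) :
    (f ∩ V).card = 1 := by
  cases h with
  | start => exact heU rfl
  | step _ _ hc hd => rwa [inter_union_eq_of_disjoint hd]

lemma exists_anti {U' : Finset α} (h : PathFrom E U e t V f) (hU : U' ⊆ U) :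
    ∃ V' ⊆ V, PathFrom E U' e t V' f := by
  induction h with
  | start => exact ⟨U', hU, .start⟩
  | step _ hg hc hd ih =>
    obtain ⟨V', hV', h'⟩ := ih
    exact ⟨_, Finset.union_subset_union_left hV', h'.step hg hc (hd.mono_right hV')⟩

lemma grow (h : PathFrom E ∅ e t V f) (he : e ∈ E) : Grow E k 0 0 0 t (V ∪ f) f := by
  induction h with
  | start => simpa using Grow.start he
  | step _ hg hc hd ih =>
    exact ih.run hg (by rwa [inter_union_eq_of_disjoint hd]) (Finset.card_pos.1 (by omega))

lemma exists_grow_union (h : PathFrom E ∅ e (t + 1) V f) (he : e ∈ E) :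
    ∃ f', Grow E k 0 0 0 t V f' := by
  cases h with
  | step h => exact ⟨_, h.grow he⟩

end PathFrom

lemma Grow.append_path (h : Grow E k j a b l U e) (hf : f ∈ E) (hfU : (f ∩ U).card = 1)
    (hp : PathFrom E U f t V q) : Grow E k (j + 1) a b (l + t + 1) (V ∪ q) q := by
  induction hp with
  | start => exact h.jump hf hfU
  | step _ hg hc hd ih =>
    exact ih.run hg (by rwa [inter_union_eq_of_disjoint hd]) (Finset.card_pos.1 (by omega))

lemma Grow.exists_append_path_init (h : Grow E k j a b l U e) (hf : f ∈ E)
    (hfU : (f ∩ U).card = 1) (hp : PathFrom E U f t V q) :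
    ∃ j' ≤ j + 1, ∃ e', Grow E k j' a b (l + t) V e' := by
  cases hp with
  | start => exact ⟨j, by omega, e, h⟩
  | step hp => exact ⟨j + 1, le_rfl, _, h.append_path hf hfU hp⟩

lemma exists_maximal_path (hT : ∀ U e, ¬ Grow E k 0 0 0 T U e) (he : e ∈ E) (U : Finset α) :
    ∃ t < T, ∃ V f, PathFrom E U e t V f ∧ ∀ g ∈ E, (g ∩ f).card = 1 → ¬ Disjoint g V := by
  by_contra! hext
  have hpaths : ∀ t ≤ T, ∃ V f, PathFrom E U e t V f := by
    intro t
    induction t with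
    | zero => exact fun _ => ⟨U, e, .start⟩
    | succ t ih =>
      intro ht
      obtain ⟨V, f, hp⟩ := ih (by omega)
      obtain ⟨g, hg, hc, hd⟩ := hext t ht V f hp
      exact ⟨_, _, hp.step hg hc hd⟩
  obtain ⟨V, f, hp⟩ := hpaths T le_rfl
  obtain ⟨V', -, hp'⟩ := hp.exists_anti (Finset.empty_subset U)
  exact hT _ _ (hp'.grow he)

lemma card_inter_lt_card {s t : Finset α} {x : α} (hxs : x ∈ s) (hxt : x ∉ t) :
    (s ∩ t).card < s.card :=
  Finset.card_lt_card ⟨Finset.inter_subset_left, fun h => hxt (Finset.mem_inter.1 (h hxs)).2⟩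

lemma card_inter_union_of_inter_eq_singleton {s t u : Finset α} {x : α} (hx : s ∩ u = {x})
    (hxt : x ∉ t) : (s ∩ (t ∪ u)).card = (s ∩ t).card + 1 := by
  rw [Finset.inter_union_distrib_left, hx, Finset.union_comm, ← Finset.insert_eq,
    Finset.card_insert_of_notMem fun h => hxt (Finset.mem_inter.1 h).2]

lemma mem_of_inter_eq_singleton {s t : Finset α} {x : α} (h : s ∩ t = {x}) : x ∈ s ∧ x ∈ t :=
  Finset.mem_inter.1 (h ▸ Finset.mem_singleton_self x)

/-! ### Critical hypergraphs contain long paths or dense sequences -/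

lemma Grow.exists_gain (hk : 3 ≤ k) (hE : Critical E k) (hT : ∀ U e, ¬ Grow E k 0 0 0 T U e)
    (h : Grow E k j a b l U e) (hf : f ∈ E) (hmeet : ¬ Disjoint f U) (hfU : ¬ f ⊆ U) :
    ∃ j' ≤ j + 2, ∃ l' ≤ l + T + 1, ∃ U' e', Grow E k j' a (b + 1) l' U' e' := by
  have lt_of_notMem {g X : Finset α} {x : α} (hg : g ∈ E) (hxg : x ∈ g) (hxX : x ∉ X) :
      (g ∩ X).card < k := hE.uniform g hg ▸ card_inter_lt_card hxg hxX
  have one_le {g X : Finset α} (hgX : ¬ Disjoint g X) : 1 ≤ (g ∩ X).card :=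
    Finset.card_pos.2 (Finset.not_disjoint_iff_nonempty_inter.1 hgX)
  obtain ⟨y, hyf, hyU⟩ := Finset.not_subset.1 hfU
  rcases (one_le hmeet).eq_or_lt' with hf1 | hf2
  swap
  · exact ⟨j + 1, by omega, l + 1, by omega, _, _, h.gain hf hf2 (lt_of_notMem hf hyf hyU)⟩
  obtain ⟨t, htT, V, q, hp, hmax⟩ := exists_maximal_path hT hf U
  have hq : q ∈ E := hp.mem hf
  obtain ⟨x, hxq, hxV⟩ : ∃ x ∈ q, x ∉ V := by
    by_contra! hqV
    have := hp.card_inter fun _ => hf1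
    rw [Finset.inter_eq_left.2 hqV, hE.uniform q hq] at this
    omega
  obtain ⟨g, hg, hgx⟩ := hE.exists_inter_eq_singleton q hq x hxq
  rcases (one_le (hmax g hg (by simp [hgx]))).eq_or_lt' with hg1 | hg2
  · have hg2 := card_inter_union_of_inter_eq_singleton hgx hxV
    exact ⟨j + 2, le_rfl, _, by omega, _, _,
      (h.append_path hf hf1 hp).gain hg (by omega) (by omega)⟩
  · obtain ⟨j', hj', e', h'⟩ := h.exists_append_path_init hf hf1 hp
    exact ⟨j' + 1, by omega, _, by omega, _, _,
      h'.gain hg hg2 (lt_of_notMem hg (mem_of_inter_eq_singleton hgx).1 hxV)⟩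

/-- `E` contains no path of `T + 1` edges and no sequence of `O(T)` edges with a step that has two
vertices in common with the preceding edges and a further one that has at least two. -/
structure LocallySparse (E : Set (Finset α)) (k T : ℕ) : Prop where
  not_path : ∀ U e, ¬ Grow E k 0 0 0 T U e
  not_dense : ∀ j ≤ 3, ∀ l ≤ 2 * T + 1, ∀ U e, ¬ Grow E k j 1 1 l U e

lemma LocallySparse.subset_or_disjoint (hs : LocallySparse E k T) (hk : 3 ≤ k) (hE : Critical E k)
    (h : Grow E k 1 1 0 l U e) (hl : l ≤ T) : ∀ f ∈ E, f ⊆ U ∨ Disjoint f U := by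
  intro f hf
  by_contra! hc
  obtain ⟨j', hj', l', hl', U', e', h'⟩ := h.exists_gain hk hE hs.not_path hf hc.2 hc.1
  exact hs.not_dense j' hj' l' (by omega) U' e' h'

lemma LocallySparse.cycle_unique (hs : LocallySparse E k T) (hk : 3 ≤ k) (hE : Critical E k)
    {l₁ l₂ : ℕ} {U₁ U₂ e₁ e₂ : Finset α} (h₁ : Grow E k 1 1 0 l₁ U₁ e₁) (hl₁ : l₁ ≤ T)
    (h₂ : Grow E k 1 1 0 l₂ U₂ e₂) (hl₂ : l₂ ≤ T) {x : α} (hx₁ : x ∈ U₁) (hx₂ : x ∈ U₂) :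
    U₁ = U₂ ∧ l₁ = l₂ := by
  have hU : U₁ = U₂ := Finset.Subset.antisymm
    ((h₁.subset_or_disjoint (hs.subset_or_disjoint hk hE h₂ hl₂)).resolve_right
      (Finset.not_disjoint_iff.2 ⟨x, hx₁, hx₂⟩))
    ((h₂.subset_or_disjoint (hs.subset_or_disjoint hk hE h₁ hl₁)).resolve_right
      (Finset.not_disjoint_iff.2 ⟨x, hx₂, hx₁⟩))
  obtain ⟨k, rfl⟩ : ∃ k', k = k' + 1 := ⟨k - 1, by omega⟩
  have hcard₁ := h₁.card_add_eq hE.uniform rfl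
  have hcard₂ := h₂.card_add_eq hE.uniform rfl
  rw [hU] at hcard₁
  exact ⟨hU, Nat.eq_of_mul_eq_mul_right (by omega : 0 < k) (by omega)⟩

-- If the closing edge `f` met the path more often, then adding `f` before the last edge `q` of the
-- path would give a dense sequence: `q` meets its predecessor and `f` in one vertex each.
lemma LocallySparse.card_inter_of_closing (hs : LocallySparse E k T) (hE : Critical E k)
    (hp : PathFrom E ∅ e (t + 1) V q) (he : e ∈ E) (htT : t < T) (hf : f ∈ E) (hfq : f ∩ q = {v})
    (hv : v ∉ V) (hfV : ¬ Disjoint f V) : (f ∩ (V ∪ q)).card = 2 := by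
  have hpos := Finset.card_pos.2 (Finset.not_disjoint_iff_nonempty_inter.1 hfV)
  suffices ¬ 2 ≤ (f ∩ V).card by
    rw [card_inter_union_of_inter_eq_singleton hfq hv]
    omega
  intro hf2
  obtain ⟨f', hV⟩ := hp.exists_grow_union (k := k) he
  have hlt := card_inter_lt_card (mem_of_inter_eq_singleton hfq).1 hv
  rw [hE.uniform f hf] at hlt
  have hq2 : (q ∩ (V ∪ f)).card = 2 := by
    rw [card_inter_union_of_inter_eq_singleton (by rwa [Finset.inter_comm]) hv,
      hp.card_inter (by simp)]
  exact hs.not_dense 2 (by omega) _ (by omega) _ _ ((hV.gain hf hf2 hlt).two (hp.mem he) hq2)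

lemma LocallySparse.card_inter_le_one (hs : LocallySparse E k T) (hT : 1 ≤ T) (hE : Critical E k)
    {f' : Finset α} {v' : α} (hf : f ∈ E) (hf' : f' ∈ E) (hq : q ∈ E) (hfq : f ∩ q = {v})
    (hfq' : f' ∩ q = {v'}) (hvv' : v' ≠ v) : (f' ∩ f).card ≤ 1 := by
  obtain ⟨hvf', hvq'⟩ := mem_of_inter_eq_singleton hfq'
  have hvf : v' ∉ f := fun h => hvv' (by simpa [hfq] using Finset.mem_inter.2 ⟨h, hvq'⟩)
  by_contra! hf2
  have hlt := card_inter_lt_card hvf' hvf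
  rw [hE.uniform f' hf'] at hlt
  have hq2 : (q ∩ (f ∪ f')).card = 2 := by
    rw [card_inter_union_of_inter_eq_singleton (by rwa [Finset.inter_comm]) hvf,
      Finset.inter_comm, hfq, Finset.card_singleton]
  exact hs.not_dense 2 (by omega) 2 (by omega) _ _ (((Grow.start hf).gain hf' hf2 hlt).two hq hq2)

-- The `k - 2` vertices of `f` outside `P` lie in `f'`, but `f` and `f'` share at most one vertex.
lemma LocallySparse.eq_three_of_union_eq (hs : LocallySparse E k T) (hT : 1 ≤ T) (hk : 3 ≤ k)
    (hE : Critical E k) {P f' : Finset α} {v' : α} (hf : f ∈ E) (hf' : f' ∈ E) (hq : q ∈ E)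
    (hfq : f ∩ q = {v}) (hfq' : f' ∩ q = {v'}) (hvv' : v' ≠ v) (hfP : (f ∩ P).card = 2)
    (hU : P ∪ f = P ∪ f') : k = 3 ∧ ∃ z, f \ P = {z} ∧ f' ∩ f = {z} := by
  have hsub : f \ P ⊆ f' ∩ f := fun w hw => by
    obtain ⟨hwf, hwP⟩ := Finset.mem_sdiff.1 hw
    have hwU : w ∈ P ∪ f' := hU ▸ Finset.mem_union_right P hwf
    exact Finset.mem_inter.2 ⟨(Finset.mem_union.1 hwU).resolve_left hwP, hwf⟩
  have hcard : (f \ P).card + 2 = k := by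
    rw [← hfP, Finset.card_sdiff_add_card_inter, hE.uniform f hf]
  have hle := hs.card_inter_le_one hT hE hf hf' hq hfq hfq' hvv'
  have hk3 : k = 3 := by linarith [Finset.card_le_card hsub]
  obtain ⟨z, hz⟩ := Finset.card_eq_one.1 (by omega : (f \ P).card = 1)
  exact ⟨hk3, z, hz, by rw [← Finset.eq_of_subset_of_card_le hsub (by omega), hz]⟩

-- Colour `z` and `u` red and all else blue. A monochromatic edge `h` in `U` avoids `z` and `u`, so
-- it meets `e` or `q` in two vertices, which gives a second cycle of another length in `U`.
lemma LocallySparse.not_cycle_of_subset_insert (hs : LocallySparse E 3 T) (hT : 2 ≤ T)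
    (hE : Critical E 3) {g : Finset α} {u z : α} (he : e ∈ E) (hq : q ∈ E) (hue : u ∈ e)
    (huq : u ∈ q) (heU : e ⊆ U) (hqU : q ⊆ U) (hU : U ⊆ insert z (e ∪ q)) :
    ¬ Grow E 3 1 1 0 2 U g := by
  intro hG
  obtain ⟨h, hh, hhU, hR⟩ := hE.exists_monochromatic U
    (hs.subset_or_disjoint le_rfl hE hG hT) ⟨q, hq, hqU⟩ {z, u}
  have hh3 := hE.uniform h hh
  have hdisj : Disjoint h {z, u} := hR.resolve_left fun hsub => by
    have := (Finset.card_le_card hsub).trans Finset.card_le_two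
    omega
  rw [Finset.disjoint_right] at hdisj
  have hheq : h = h ∩ e ∪ h ∩ q := by
    rw [← Finset.inter_union_distrib_left, eq_comm, Finset.inter_eq_left]
    intro w hw
    refine (Finset.mem_insert.1 (hU (hhU hw))).resolve_left ?_
    rintro rfl
    exact hdisj (by simp) hw
  have hle_one : ∀ r ∈ E, u ∈ r → r ⊆ U → (h ∩ r).card ≤ 1 := by
    intro r hr hur hrU
    by_contra! h2
    have hlt := card_inter_lt_card hur (hdisj (by simp))
    rw [hE.uniform r hr, Finset.inter_comm] at hlt
    have hcycle := (Grow.start (k := 3) hr).two hh (by omega)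
    have := (hs.cycle_unique le_rfl hE hcycle (by omega) hG hT (Finset.mem_union_left _ hur)
      (hrU hur)).2
    omega
  have hcard := Finset.card_union_le (h ∩ e) (h ∩ q)
  rw [← hheq] at hcard
  linarith [hle_one e he hue heU, hle_one q hq huq hqU]

lemma Critical.exists_path_with_two_new_vertices (hE : Critical E k) (hk : 3 ≤ k)
    (hT : ∀ U e, ¬ Grow E k 0 0 0 T U e) :
    ∃ e ∈ E, ∃ t, t + 1 < T ∧ ∃ V q, PathFrom E ∅ e (t + 1) V q ∧
      (∀ g ∈ E, (g ∩ q).card = 1 → ¬ Disjoint g V) ∧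
      ∃ v ∈ q, v ∉ V ∧ ∃ v' ∈ q, v' ∉ V ∧ v' ≠ v := by
  obtain ⟨e, he⟩ := hE.nonempty
  obtain ⟨t, htT, V, q, hp, hmax⟩ := exists_maximal_path hT he ∅
  have hqk := hE.uniform q (hp.mem he)
  obtain _ | t := t
  · cases hp
    obtain ⟨x, hx⟩ := Finset.card_pos.1 (by omega : 0 < e.card)
    obtain ⟨g, hg, hge⟩ := hE.exists_inter_eq_singleton e he x hx
    exact absurd (Finset.disjoint_empty_right g) (hmax g hg (by simp [hge]))
  have hnew : 1 < (q \ V).card := by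
    have := Finset.card_sdiff_add_card_inter q V
    have := hp.card_inter (by simp)
    omega
  obtain ⟨v, hv, v', hv', hvv'⟩ := Finset.one_lt_card.1 hnew
  rw [Finset.mem_sdiff] at hv hv'
  exact ⟨e, he, t, htT, V, q, hp, hmax, v, hv.1, hv.2, v', hv'.1, hv'.2, hvv'.symm⟩

-- The last edge `q` of a maximal path is linked back by two edges `f` and `f'`. The two cycles
-- share `q`, hence have the same vertices. This forces `k = 3` and the path to have two edges `e`
-- and `q`, so that `e`, `q`, `f`, `f'` are four triples on six points, any two sharing one point.
theorem Critical.not_locallySparse (hE : Critical E k) (hk : 3 ≤ k) : ¬ LocallySparse E k T := by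
  intro hs
  obtain ⟨e, he, t, htT, V, q, hp, hmax, v, hvq, hvV, v', hvq', hvV', hvv'⟩ :=
    hE.exists_path_with_two_new_vertices hk hs.not_path
  have hq : q ∈ E := hp.mem he
  obtain ⟨f, hf, hfq⟩ := hE.exists_inter_eq_singleton q hq v hvq
  obtain ⟨f', hf', hfq'⟩ := hE.exists_inter_eq_singleton q hq v' hvq'
  have hf2 := hs.card_inter_of_closing hE hp he (by omega) hf hfq hvV (hmax f hf (by simp [hfq]))
  have hf2' := hs.card_inter_of_closing hE hp he (by omega) hf' hfq' hvV'
    (hmax f' hf' (by simp [hfq']))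
  have hG := (hp.grow (k := k) he).two hf hf2
  have hG' := (hp.grow (k := k) he).two hf' hf2'
  have hqP : q ⊆ V ∪ q := Finset.subset_union_right
  have hUU := (hs.cycle_unique hk hE hG (by omega) hG' (by omega)
    (Finset.mem_union_left _ (hqP hvq)) (Finset.mem_union_left _ (hqP hvq))).1
  obtain ⟨rfl, z, hz, hff⟩ :=
    hs.eq_three_of_union_eq (by omega) hk hE hf hf' hq hfq hfq' hvv' hf2 hUU
  have htriangle : Grow E 3 1 1 0 2 (f ∪ f' ∪ q) q :=
    ((Grow.start hf).run hf' (by simp [hff]) (by simp [hff])).two hq <| by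
      rw [card_inter_union_of_inter_eq_singleton (by rwa [Finset.inter_comm]), Finset.inter_comm,
        hfq, Finset.card_singleton]
      exact fun h => hvv' (by simpa [hfq] using Finset.mem_inter.2 ⟨h, hvq'⟩)
  have ht : t = 0 := by
    have := (hs.cycle_unique hk hE hG (by omega) htriangle (by omega)
      (Finset.mem_union_left _ (hqP hvq)) (Finset.mem_union_right _ hvq)).2
    omega
  subst ht
  obtain ⟨u, hu⟩ := Finset.card_eq_one.1 (hp.card_inter (by simp))
  obtain ⟨huq, huV⟩ := mem_of_inter_eq_singleton hu
  obtain rfl : V = e := by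
    cases hp with
    | step hp => cases hp; simp
  refine hs.not_cycle_of_subset_insert (z := z) (by omega) hE he hq huV huq
    (Finset.subset_union_left.trans Finset.subset_union_left) (hqP.trans Finset.subset_union_left)
    ?_ hG
  rw [← Finset.union_sdiff_self_eq_union, hz, Finset.union_comm, Finset.insert_eq]

end Hypergraph

/-! ### The first moment method for sequences of sets -/

section Weights

variable {α : Type*} [DecidableEq α]

/-- The union of a list of finite sets. -/
def listUnion (L : List (Finset α)) : Finset α := L.foldr (· ∪ ·) ∅

lemma listUnion_cons (e : Finset α) (L : List (Finset α)) :
    listUnion (e :: L) = e ∪ listUnion L := rfl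

/-- The lists of length `m + 1` with members in `E`. -/
def lists (E : Finset (Finset α)) : ℕ → Finset (List (Finset α))
  | 0 => E.image fun e => [e]
  | m + 1 => (E ×ˢ lists E m).image fun x => x.1 :: x.2

/-- The product of the weights of the steps of a sequence of sets, which is listed from last to
first. Here `w U e f` is the weight of adding `f` to a sequence with union `U` and last
member `e`. -/
def listWeight (w : Finset α → Finset α → Finset α → ℝ) : List (Finset α) → ℝ
  | [] => 1
  | [_] => 1
  | f :: e :: L => w (listUnion (e :: L)) e f * listWeight w (e :: L)

variable {w : Finset α → Finset α → Finset α → ℝ} {E : Finset (Finset α)} {k m : ℕ}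
  {L : List (Finset α)}

lemma mem_lists_zero : L ∈ lists E 0 ↔ ∃ e ∈ E, [e] = L := by
  simp [lists]

lemma mem_lists_succ : L ∈ lists E (m + 1) ↔ ∃ e ∈ E, ∃ L' ∈ lists E m, e :: L' = L := by
  simp [lists, and_assoc]

lemma exists_cons_of_mem_lists (h : L ∈ lists E m) : ∃ e ∈ E, ∃ L', L = e :: L' := by
  cases m with
  | zero =>
    obtain ⟨e, he, rfl⟩ := mem_lists_zero.1 h
    exact ⟨e, he, [], rfl⟩
  | succ m =>
    obtain ⟨e, he, L', -, rfl⟩ := mem_lists_succ.1 h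
    exact ⟨e, he, L', rfl⟩

lemma card_listUnion_le (hu : ∀ e ∈ E, e.card ≤ k) (h : L ∈ lists E m) :
    (listUnion L).card ≤ k * (m + 1) := by
  induction m generalizing L with
  | zero =>
    obtain ⟨e, he, rfl⟩ := mem_lists_zero.1 h
    simpa [listUnion] using hu e he
  | succ m ih =>
    obtain ⟨e, he, L', hL', rfl⟩ := mem_lists_succ.1 h
    calc (listUnion (e :: L')).card ≤ e.card + (listUnion L').card := Finset.card_union_le ..
      _ ≤ k + k * (m + 1) := add_le_add (hu e he) (ih hL')
      _ = k * (m + 1 + 1) := by ring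

lemma listWeight_nonneg (hw : ∀ U e f, 0 ≤ w U e f) (L : List (Finset α)) :
    0 ≤ listWeight w L := by
  induction L using listWeight.induct with
  | case1 | case2 => exact zero_le_one
  | case3 f e L ih => exact mul_nonneg (hw _ _ _) ih

lemma listWeight_mul_pow_cons (p : ℝ) (e f : Finset α) (L : List (Finset α)) :
    listWeight w (f :: e :: L) * p ^ (listUnion (f :: e :: L)).card =
      w (listUnion (e :: L)) e f * p ^ (f \ listUnion (e :: L)).card *
        (listWeight w (e :: L) * p ^ (listUnion (e :: L)).card) := by
  rw [listUnion_cons f, ← Finset.sdiff_union_self_eq_union,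
    Finset.card_union_of_disjoint Finset.sdiff_disjoint, pow_add, listWeight]
  ring

lemma sum_lists_le {p M κ : ℝ} {N : ℕ} (hp : 0 ≤ p) (hw : ∀ U e f, 0 ≤ w U e f) (hκ : 0 ≤ κ)
    (hu : ∀ e ∈ E, e.card ≤ k) (hM : ∑ e ∈ E, p ^ e.card ≤ M)
    (hstep : ∀ U e : Finset α, U.card ≤ k * N → e ⊆ U → e ∈ E →
      ∑ f ∈ E, w U e f * p ^ (f \ U).card ≤ κ) (hm : m ≤ N) :
    ∑ L ∈ lists E m, listWeight w L * p ^ (listUnion L).card ≤ M * κ ^ m := by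
  induction m with
  | zero =>
    rw [lists, Finset.sum_image (by simp)]
    simpa [listWeight, listUnion] using hM
  | succ m ih =>
    have hinj : Set.InjOn (fun x : Finset α × List (Finset α) => x.1 :: x.2)
        (E ×ˢ lists E m : Finset _) := by
      rintro ⟨e, L⟩ - ⟨f, L'⟩ - h
      simpa using h
    rw [lists, Finset.sum_image hinj, Finset.sum_product_right]
    calc _ ≤ ∑ L ∈ lists E m, κ * (listWeight w L * p ^ (listUnion L).card) := by
          refine Finset.sum_le_sum fun L hL => ?_
          have hcard := (card_listUnion_le hu hL).trans (Nat.mul_le_mul_left _ hm)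
          obtain ⟨e, he, L', rfl⟩ := exists_cons_of_mem_lists hL
          simp only [listWeight_mul_pow_cons, ← Finset.sum_mul]
          have := listWeight_nonneg hw (e :: L')
          gcongr
          exact hstep _ e hcard Finset.subset_union_left he
      _ = κ * ∑ L ∈ lists E m, listWeight w L * p ^ (listUnion L).card := by
          rw [← Finset.mul_sum]
      _ ≤ κ * (M * κ ^ m) := by
          gcongr
          exact ih (by omega)
      _ = M * κ ^ (m + 1) := by ring

lemma setBernoulli_real_superset_le {ι : Type*} (u : Set ι) (p : I) (U : Finset ι) :
    (setBernoulli u p).real {S | (U : Set ι) ⊆ S} ≤ (p : ℝ) ^ U.card := by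
  have hpi : (fun P : ι → Prop => {i | P i}) ⁻¹' {S | (U : Set ι) ⊆ S} =
      Set.pi U (fun _ => {True}) := by
    ext P
    simp [Set.subset_def, Set.mem_pi]
  have hle : setBernoulli u p {S | (U : Set ι) ⊆ S} ≤ (toNNReal p : ENNReal) ^ U.card := by
    rw [setBernoulli_apply', hpi, Measure.infinitePi_pi _ (fun _ _ => MeasurableSet.of_discrete)]
    calc _ ≤ ∏ _i ∈ U, (toNNReal p : ENNReal) := by
          refine Finset.prod_le_prod' fun i _ => ?_
          by_cases hi : i ∈ u <;> simp [Measure.add_apply, Measure.smul_apply, hi]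
      _ = _ := by simp
  simpa [measureReal_def] using ENNReal.toReal_mono (by simp) hle

lemma measureReal_exists_list_le (u : Set α) (p : I) (hw : ∀ U e f, 0 ≤ w U e f) {c B : ℝ}
    (hc : 0 < c) (hB : ∑ L ∈ lists E m, listWeight w L * (p : ℝ) ^ (listUnion L).card ≤ B) :
    (setBernoulli u p).real {S | ∃ L ∈ lists E m, c ≤ listWeight w L ∧
      (listUnion L : Set α) ⊆ S} ≤ B / c := by
  classical
  have hsub : {S | ∃ L ∈ lists E m, c ≤ listWeight w L ∧ (listUnion L : Set α) ⊆ S} ⊆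
      ⋃ L ∈ (lists E m).filter (fun L => c ≤ listWeight w L), {S | (listUnion L : Set α) ⊆ S} := by
    rintro S ⟨L, hL, hcL, hS⟩
    simp only [Set.mem_iUnion]
    exact ⟨L, Finset.mem_filter.2 ⟨hL, hcL⟩, hS⟩
  refine (measureReal_mono hsub (measure_ne_top _ _)).trans
    ((measureReal_biUnion_finset_le _ _).trans ?_)
  rw [le_div_iff₀ hc, Finset.sum_mul]
  refine le_trans (Finset.sum_le_sum fun L hL => ?_) ((Finset.sum_le_sum_of_subset_of_nonneg
    (Finset.filter_subset _ _) fun L _ _ =>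
      mul_nonneg (listWeight_nonneg hw L) (pow_nonneg p.2.1 _)).trans hB)
  rw [mul_comm]
  exact mul_le_mul (Finset.mem_filter.1 hL).2 (setBernoulli_real_superset_le u p _)
    measureReal_nonneg (listWeight_nonneg hw L)

end Weights

section StepWeight

variable {α : Type*} [DecidableEq α]

/-- The weight of adding `f` to a sequence of `k`-sets with union `U` and last member `e`: it is `1`
for a step along a path, and `s * g i` for any other step with `i` old vertices where
`1 ≤ i < k`. -/
def stepWeight (k : ℕ) (s : ℝ) (g : ℕ → ℝ) (U e f : Finset α) : ℝ :=
  if (f ∩ U).card = 1 ∧ (f ∩ e).Nonempty then 1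
  else if 1 ≤ (f ∩ U).card ∧ (f ∩ U).card < k then s * g (f ∩ U).card
  else 0

variable {k : ℕ} {s γ : ℝ} {g : ℕ → ℝ} {E : Finset (Finset α)}

lemma stepWeight_nonneg (hs : 0 ≤ s) (hg : ∀ i, 0 ≤ g i) (U e f : Finset α) :
    0 ≤ stepWeight k s g U e f := by
  have := hg (f ∩ U).card
  unfold stepWeight
  positivity

lemma exists_list_step {U e f : Finset α} {w : Finset α → Finset α → Finset α → ℝ} {x y : ℝ}
    {l : ℕ} (hw : ∀ U e f, 0 ≤ w U e f) (hy : 0 ≤ y) (hf : f ∈ E) (hx : x ≤ w U e f)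
    (h : ∃ L, e :: L ∈ lists E l ∧ listUnion (e :: L) = U ∧ y ≤ listWeight w (e :: L)) :
    ∃ L, f :: L ∈ lists E (l + 1) ∧ listUnion (f :: L) = U ∪ f ∧
      x * y ≤ listWeight w (f :: L) := by
  obtain ⟨L, hL, rfl, hyL⟩ := h
  refine ⟨e :: L, mem_lists_succ.2 ⟨f, hf, _, hL, rfl⟩, ?_, mul_le_mul hx hyL hy (hw _ _ _)⟩
  rw [listUnion_cons, Finset.union_comm]

lemma Grow.exists_list {j a b l : ℕ} {U e : Finset α} (hk : 3 ≤ k) (hs : 0 ≤ s) (hs1 : s ≤ 1)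
    (hg : ∀ i, 0 ≤ g i) (hg1 : 1 ≤ g 1) (hγ : 0 ≤ γ) (hγg : ∀ i, 2 ≤ i → γ ≤ g i)
    (h : Grow (E : Set (Finset α)) k j a b l U e) :
    ∃ L, e :: L ∈ lists E l ∧ listUnion (e :: L) = U ∧
      s ^ j * g 2 ^ a * γ ^ b ≤ listWeight (stepWeight k s g) (e :: L) := by
  have hg2 := hg 2
  have hnonneg (j a b : ℕ) : 0 ≤ s ^ j * g 2 ^ a * γ ^ b := by positivity
  have hw := stepWeight_nonneg (α := α) (k := k) hs hg
  induction h with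
  | start he => exact ⟨[], mem_lists_zero.2 ⟨_, he, rfl⟩, by simp [listUnion], by simp [listWeight]⟩
  | run _ hf hc hm ih =>
    simpa using exists_list_step hw (hnonneg ..) hf (by simp [stepWeight, hc, hm]) ih (x := 1)
  | @jump j a b _ _ _ _ _ hf hc ih =>
    convert exists_list_step hw (hnonneg ..) hf (x := s) ?_ ih using 5
    · ring
    · rw [stepWeight, hc, if_pos (by omega : 1 ≤ 1 ∧ 1 < k)]
      split_ifs
      exacts [hs1, le_mul_of_one_le_right hs hg1]
  | two _ hf hc ih =>
    convert exists_list_step hw (hnonneg ..) hf (x := s * g 2) ?_ ih using 5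
    · ring
    · simp [stepWeight, hc, (by omega : 2 < k)]
  | gain _ hf hc hc' ih =>
    convert exists_list_step hw (hnonneg ..) hf (x := s * γ) ?_ ih using 5
    · ring
    · rw [stepWeight, if_neg (by omega), if_pos (by omega)]
      gcongr
      exact hγg _ hc

/-- Upper bounds for the numbers of edges of the `k`-uniform hypergraph `E`, of those meeting an
edge in one vertex, and of those meeting a set `X` in fewer than `k` vertices, each of them weighted
with the probability that the new vertices of the edge belong to a random set of density `p` and
with the factor `g i` for an edge meeting `X` in `i` vertices. -/
structure DegreeBounds (E : Finset (Finset α)) (k : ℕ) (p : ℝ) (g : ℕ → ℝ) (C : ℝ) : Prop where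
  uniform : ∀ e ∈ E, e.card = k
  sum_le : ∑ e ∈ E, p ^ e.card ≤ 2 * g 2
  sum_inter_eq_one_le : ∀ e ∈ E, ∑ f ∈ E with (f ∩ e).card = 1, p ^ (k - 1) ≤ 1 / 2
  sum_inter_lt_le : ∀ X : Finset α, X.Nonempty →
    ∑ f ∈ E with 1 ≤ (f ∩ X).card ∧ (f ∩ X).card < k,
      g (f ∩ X).card * p ^ (k - (f ∩ X).card) ≤ C * X.card ^ k

variable {p C : ℝ}

lemma DegreeBounds.sum_stepWeight_le (h : DegreeBounds E k p g C) (hp : 0 ≤ p) (hs : 0 ≤ s)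
    (hg : ∀ i, 0 ≤ g i) {U e : Finset α} (hU : U.Nonempty) (heU : e ⊆ U) (he : e ∈ E) :
    ∑ f ∈ E, stepWeight k s g U e f * p ^ (f \ U).card ≤ 1 / 2 + s * (C * U.card ^ k) := by
  refine le_trans ?_ (add_le_add (h.sum_inter_eq_one_le e he)
    (mul_le_mul_of_nonneg_left (h.sum_inter_lt_le U hU) hs))
  rw [Finset.sum_filter, Finset.sum_filter, Finset.mul_sum, ← Finset.sum_add_distrib]
  refine Finset.sum_le_sum fun f hf => ?_
  have hnew : (f \ U).card = k - (f ∩ U).card := by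
    rw [← h.uniform f hf, ← Finset.card_sdiff_add_card_inter f U, Nat.add_sub_cancel]
  have hgi := hg (f ∩ U).card
  rw [hnew]
  by_cases hpath : (f ∩ U).card = 1 ∧ (f ∩ e).Nonempty
  · have hone : (f ∩ e).card = 1 := le_antisymm
      (hpath.1 ▸ Finset.card_le_card (Finset.inter_subset_inter_left heU))
      (Finset.card_pos.2 hpath.2)
    rw [stepWeight, if_pos hpath, if_pos hone, hpath.1, one_mul]
    rw [hpath.1] at hgi
    exact le_add_of_nonneg_right (by positivity)
  · rw [stepWeight, if_neg hpath]
    refine le_add_of_nonneg_of_le (by positivity) (le_of_eq ?_)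
    split_ifs <;> ring

/-- The edges of `E` with all vertices in `S`. -/
def inducedEdges (E : Finset (Finset α)) (S : Set α) : Set (Finset α) :=
  {e | e ∈ E ∧ (e : Set α) ⊆ S}

lemma DegreeBounds.measureReal_exists_grow_le (u : Set α) {p : I} (h : DegreeBounds E k p g C)
    (hk : 3 ≤ k) (hs : 0 ≤ s) (hs1 : s ≤ 1) (hg : ∀ i, 0 < g i) (hg1 : 1 ≤ g 1) (hγ : 0 < γ)
    (hγg : ∀ i, 2 ≤ i → γ ≤ g i) (hC : 0 ≤ C) {J a b l N : ℕ} (hJ : 0 < s ^ J) (hl : l ≤ N) :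
    (setBernoulli u p).real {S | ∃ j ≤ J, ∃ U e,
      Grow (inducedEdges E S) k j a b l U e} ≤
      2 * g 2 * (1 / 2 + s * (C * (k * N) ^ k)) ^ l / (s ^ J * g 2 ^ a * γ ^ b) := by
  have hg0 := fun i => (hg i).le
  have hg2 := hg 2
  have hsum := sum_lists_le (w := stepWeight k s g) (k := k) (N := N) p.2.1
    (stepWeight_nonneg hs hg0) (κ := 1 / 2 + s * (C * (k * N) ^ k)) (by positivity)
    (fun e he => (h.uniform e he).le) h.sum_le (fun U e hU heU he => ?_) hl
  · refine (measureReal_mono ?_ (measure_ne_top _ _)).trans (measureReal_exists_list_le u p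
      (stepWeight_nonneg hs hg0) (by positivity : 0 < s ^ J * g 2 ^ a * γ ^ b) hsum)
    rintro S ⟨j, hj, U, e, hG⟩
    obtain ⟨L, hL, rfl, hwL⟩ :=
      (hG.mono fun e he => he.1 : Grow (E : Set (Finset α)) ..).exists_list hk hs hs1 hg0 hg1 hγ.le
        hγg
    refine ⟨e :: L, hL, le_trans ?_ hwL, hG.union_induction (motive := fun U => (U : Set α) ⊆ S)
      (fun e he => he.2) fun U f hf _ hU => ?_⟩
    · gcongr ?_ * _ * _
      exact pow_le_pow_of_le_one hs hs1 hj
    · rw [Finset.coe_union]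
      exact Set.union_subset hU hf.2
  · have hene : e.Nonempty := Finset.card_pos.1 (by rw [h.uniform e he]; omega)
    refine (h.sum_stepWeight_le p.2.1 hs hg0 (hene.mono heU) heU he).trans ?_
    gcongr
    exact_mod_cast hU

lemma setOf_exists_critical_subset (hk : 3 ≤ k) (T : ℕ) :
    {S : Set α | ∃ E' ⊆ inducedEdges E S, Critical E' k} ⊆
      {S | ∃ j ≤ 0, ∃ U e, Grow (inducedEdges E S) k j 0 0 T U e} ∪
      ⋃ l ∈ Finset.range (2 * T + 2),
        {S | ∃ j ≤ 3, ∃ U e, Grow (inducedEdges E S) k j 1 1 l U e} := by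
  rintro S ⟨E', hE', hcrit⟩
  by_contra hS
  simp only [Set.mem_union, Set.mem_iUnion, Finset.mem_range, not_or, not_exists] at hS
  exact hcrit.not_locallySparse hk (T := T)
    ⟨fun U e hG => hS.1 ⟨0, le_rfl, U, e, hG.mono hE'⟩,
      fun j hj l hl U e hG => hS.2 l (by omega) ⟨j, hj, U, e, hG.mono hE'⟩⟩

theorem DegreeBounds.measureReal_exists_critical_le (u : Set α) {p : I}
    (h : DegreeBounds E k p g C) (hk : 3 ≤ k) (hg : ∀ i, 0 < g i) (hg1 : 1 ≤ g 1) (hγ : 0 < γ)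
    (hγg : ∀ i, 2 ≤ i → γ ≤ g i) (hC : 1 ≤ C) (T : ℕ) :
    (setBernoulli u p).real {S | ∃ E' ⊆ inducedEdges E S, Critical E' k} ≤
      2 * g 2 * (1 / 2) ^ T +
        (2 * T + 2) * (2 * (2 * (C * (k * (2 * T + 2)) ^ k)) ^ 3 / γ) := by
  set K : ℝ := C * (k * (2 * T + 2)) ^ k with hK
  have hk1 : (1 : ℝ) ≤ k := by exact_mod_cast (by omega : 1 ≤ k)
  have hK1 : 1 ≤ K := one_le_mul_of_one_le_of_one_le hC
    (one_le_pow₀ (one_le_mul_of_one_le_of_one_le hk1 (by linarith [T.cast_nonneg (α := ℝ)])))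
  have hs1 : 1 / (2 * K) ≤ 1 := (div_le_one (by positivity)).2 (by linarith)
  have hg2 := hg 2
  have hpath := h.measureReal_exists_grow_le u hk le_rfl zero_le_one hg hg1 hγ hγg
    (zero_le_one.trans hC) (J := 0) (a := 0) (b := 0) (l := T) (by simp) le_rfl
  have hdense (l : ℕ) (hl : l ≤ 2 * T + 1) := h.measureReal_exists_grow_le u hk
    (by positivity : 0 ≤ 1 / (2 * K)) hs1 hg hg1 hγ hγg (zero_le_one.trans hC) (J := 3) (a := 1)
    (b := 1) (by positivity) (hl.trans (Nat.le_succ _))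
  refine (measureReal_mono (setOf_exists_critical_subset hk T) (measure_ne_top _ _)).trans
    ((measureReal_union_le _ _).trans
    (add_le_add (by simpa using hpath) ((measureReal_biUnion_finset_le _ _).trans
      ((Finset.sum_le_sum fun l hl => hdense l (by grind)).trans (le_of_eq ?_)))))
  have hhalf : (1 : ℝ) / 2 + 1 / (2 * K) * (C * (k * ((2 * T + 1).succ : ℕ)) ^ k) = 1 := by
    rw [show (k : ℝ) * ((2 * T + 1).succ : ℕ) = k * (2 * T + 2) by push_cast; ring, ← hK]
    field_simp
    norm_num
  simp only [hhalf, one_pow, mul_one, pow_one, Finset.sum_const, Finset.card_range, nsmul_eq_mul]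
  push_cast
  field_simp

end StepWeight

/-! ### Hypergraphs of solutions -/

section Solutions

variable {k : ℕ}

open scoped Classical in
/-- The injective members of `Y` with coordinates in `{1, …, n}`. -/
def solutions (Y : Set (Fin k → ℤ)) (n : ℕ) : Finset (Fin k → ℤ) :=
  {y ∈ Fintype.piFinset fun _ => Finset.Icc (1 : ℤ) n | Function.Injective y ∧ y ∈ Y}

lemma mem_solutions {Y : Set (Fin k → ℤ)} {n : ℕ} {y : Fin k → ℤ} :
    y ∈ solutions Y n ↔ (∀ j, 1 ≤ y j ∧ y j ≤ n) ∧ Function.Injective y ∧ y ∈ Y := by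
  simp [solutions]

/-- The hypergraph on `{1, …, n}` whose edges are the coordinate sets of the injective members of
`Y 0` and of `Y 1`. -/
def edges (Y : Fin 2 → Set (Fin k → ℤ)) (n : ℕ) : Finset (Finset ℤ) :=
  (Finset.univ.sigma fun i => solutions (Y i) n).image fun x => Finset.univ.image x.2

lemma mem_edges {Y : Fin 2 → Set (Fin k → ℤ)} {n : ℕ} {e : Finset ℤ} :
    e ∈ edges Y n ↔ ∃ i, ∃ y ∈ solutions (Y i) n, Finset.univ.image y = e := by
  simp [edges]

lemma card_of_mem_edges {Y : Fin 2 → Set (Fin k → ℤ)} {n : ℕ} {e : Finset ℤ}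
    (he : e ∈ edges Y n) : e.card = k := by
  obtain ⟨i, y, hy, rfl⟩ := mem_edges.1 he
  rw [Finset.card_image_of_injective _ (mem_solutions.1 hy).2.1, Finset.card_univ,
    Fintype.card_fin]

/-- `Y` has few members in a box, also after restricting the coordinates in some set `W` to finitely
many values. Here `D` plays the role of the dimension of `Y` and `r W` that of its projection to the
coordinates in `W`; the field `balanced` is the strict inequality `(|W| - 1) / (r W - 1) <
(k - 1) / (D - 1)` cleared of denominators. -/
structure Sparse (D : ℕ) (r : Finset (Fin k) → ℕ) (Y : Set (Fin k → ℤ)) : Prop where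
  le : ∀ W, r W ≤ D
  one_le : ∀ W, W.card = 1 → 1 ≤ r W
  two_le : ∀ W, W.card = 2 → 2 ≤ r W
  balanced : ∀ W, 2 ≤ W.card → W.card < k →
    ((W.card : ℤ) - 1) * (D - 1) < (k - 1) * (r W - 1)
  card_le : ∀ n, 1 ≤ n → ∀ (X : Finset ℤ) (W : Finset (Fin k)),
    {y ∈ solutions Y n | ∀ j ∈ W, y j ∈ X}.card ≤ X.card ^ W.card * n ^ (D - r W)

lemma card_image_inter_of_injective {y : Fin k → ℤ} (hy : Function.Injective y) (X : Finset ℤ) :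
    (Finset.univ.image y ∩ X).card = (Finset.univ.filter fun j => y j ∈ X).card := by
  rw [← Finset.card_image_of_injective _ hy, ← Finset.filter_mem_eq_inter, Finset.filter_image]

variable {D : ℕ} {r : Fin 2 → Finset (Fin k) → ℕ} {Y : Fin 2 → Set (Fin k → ℤ)}

/-- Group the solutions according to the set `W` of coordinates that fall into `X`. -/
lemma sum_edges_le (hY : ∀ i, Sparse D (r i) (Y i)) {n : ℕ} (hn : 1 ≤ n) (X : Finset ℤ)
    {φ : ℕ → ℝ} (hφ : ∀ w, 0 ≤ φ w) :
    ∑ f ∈ edges Y n, φ (f ∩ X).card ≤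
      ∑ i, ∑ W : Finset (Fin k), (X.card : ℝ) ^ W.card * (n : ℝ) ^ (D - r i W) * φ W.card := by
  refine (Finset.sum_image_le_of_nonneg fun _ _ => hφ _).trans ?_
  rw [Finset.sum_sigma]
  refine Finset.sum_le_sum fun i _ => ?_
  rw [← Finset.sum_fiberwise (solutions (Y i) n) fun y => Finset.univ.filter fun j => y j ∈ X]
  refine Finset.sum_le_sum fun W _ => ?_
  have hconst : ∀ y ∈ (solutions (Y i) n).filter
      (fun y => (Finset.univ.filter fun j => y j ∈ X) = W),
      φ (Finset.univ.image y ∩ X).card = φ W.card := by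
    intro y hy
    rw [Finset.mem_filter] at hy
    rw [card_image_inter_of_injective (mem_solutions.1 hy.1).2.1, hy.2]
  have hsub : (solutions (Y i) n).filter (fun y => (Finset.univ.filter fun j => y j ∈ X) = W) ⊆
      {y ∈ solutions (Y i) n | ∀ j ∈ W, y j ∈ X} := by
    intro y hy
    rw [Finset.mem_filter] at hy ⊢
    refine ⟨hy.1, fun j hj => ?_⟩
    rw [← hy.2] at hj
    exact (Finset.mem_filter.1 hj).2
  rw [Finset.sum_congr rfl hconst, Finset.sum_const, nsmul_eq_mul]
  refine mul_le_mul_of_nonneg_right ?_ (hφ _)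
  exact_mod_cast (Finset.card_le_card hsub).trans ((hY i).card_le n hn X W)

lemma card_edges_le (hY : ∀ i, Sparse D (r i) (Y i)) {n : ℕ} (hn : 1 ≤ n) :
    (edges Y n).card ≤ 2 * n ^ D := by
  have hsol : ∀ i, (solutions (Y i) n).card ≤ n ^ D := fun i => by
    have := (hY i).card_le n hn ∅ ∅
    simp only [Finset.notMem_empty, false_imp_iff, implies_true, Finset.filter_true,
      Finset.card_empty, pow_zero, one_mul] at this
    exact this.trans (Nat.pow_le_pow_right hn (Nat.sub_le _ _))
  calc (edges Y n).card ≤ ∑ i, (solutions (Y i) n).card := by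
        rw [← Finset.card_sigma]; exact Finset.card_image_le
    _ ≤ ∑ _i : Fin 2, n ^ D := Finset.sum_le_sum fun i _ => hsol i
    _ = 2 * n ^ D := by simp

/-- The exponent `θ` of the threshold probability `n ^ (-θ)`. -/
def expo (k D : ℕ) : ℝ := ((D : ℝ) - 1) / ((k : ℝ) - 1)

lemma expo_mul (hk : k ≠ 1) : expo k D * ((k : ℝ) - 1) = D - 1 :=
  div_mul_cancel₀ _ (sub_ne_zero.2 (by exact_mod_cast hk))

lemma expo_pos (hD : 2 ≤ D) (hDk : D < k) : 0 < expo k D := by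
  have hD' : (2 : ℝ) ≤ D := by exact_mod_cast hD
  have hDk' : (D : ℝ) < k := by exact_mod_cast hDk
  exact div_pos (by linarith) (by linarith)

lemma one_div_le_one_sub_expo (hk : 2 ≤ k) (hDk : D < k) :
    1 / ((k : ℝ) - 1) ≤ 1 - expo k D := by
  have hk' : (2 : ℝ) ≤ k := by exact_mod_cast hk
  have hDk' : (D : ℝ) + 1 ≤ k := by exact_mod_cast hDk
  rw [div_le_iff₀ (by linarith), sub_mul, expo_mul (by omega)]
  linarith

/-- A step with `w` old vertices is rarer than one with a single old vertex by the factor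
`n ^ gainExp k D w`. The value for `w = 2` is chosen to cancel the number `n ^ (1 - θ)` of edges in
the random set, and strict balancedness provides the value for `w ≥ 3`. -/
def gainExp (k D w : ℕ) : ℝ :=
  if w = 1 then 0 else if w = 2 then 1 - expo k D else 1 / ((k : ℝ) - 1)

lemma one_div_le_gainExp (hk : 2 ≤ k) (hDk : D < k) {w : ℕ} (hw : 2 ≤ w) :
    1 / ((k : ℝ) - 1) ≤ gainExp k D w := by
  rw [gainExp, if_neg (by omega)]
  split_ifs
  · exact one_div_le_one_sub_expo hk hDk
  · exact le_rfl

lemma Sparse.expo_mul_add_gainExp_le {r : Finset (Fin k) → ℕ} {Y : Set (Fin k → ℤ)}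
    (hY : Sparse D r Y) {W : Finset (Fin k)} (h1 : 1 ≤ W.card) (hk : W.card < k) :
    expo k D * ((W.card : ℝ) - 1) + gainExp k D W.card ≤ r W - 1 := by
  have hk1 : (1 : ℝ) < k := by exact_mod_cast h1.trans_lt hk
  unfold gainExp
  split_ifs with hw1 hw2
  · have : (1 : ℝ) ≤ r W := by exact_mod_cast hY.one_le W hw1
    rw [hw1, Nat.cast_one]
    linarith
  · have : (2 : ℝ) ≤ r W := by exact_mod_cast hY.two_le W hw2
    rw [hw2, Nat.cast_ofNat]
    linarith
  · have hb : ((W.card : ℝ) - 1) * (D - 1) + 1 ≤ (k - 1) * ((r W : ℝ) - 1) := by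
      exact_mod_cast Int.add_one_le_of_lt (hY.balanced W (by omega) hk)
    rw [expo, div_mul_eq_mul_div, ← add_div, div_le_iff₀ (by linarith)]
    linarith

variable {n : ℕ} {p c : ℝ}

lemma pow_mul_pow_le (hn : 1 ≤ n) (hp0 : 0 ≤ p) {θ : ℝ} (hp : p ≤ c * (n : ℝ) ^ (-θ))
    (d m : ℕ) : (n : ℝ) ^ d * p ^ m ≤ c ^ m * (n : ℝ) ^ ((d : ℝ) - θ * m) := by
  have hn' : (0 : ℝ) < n := by exact_mod_cast hn
  calc (n : ℝ) ^ d * p ^ m ≤ (n : ℝ) ^ d * (c * (n : ℝ) ^ (-θ)) ^ m := by gcongr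
    _ = c ^ m * ((n : ℝ) ^ (d : ℝ) * (n : ℝ) ^ (-θ * m)) := by
        rw [mul_pow, Real.rpow_mul hn'.le, Real.rpow_natCast, Real.rpow_natCast]; ring
    _ = _ := by rw [← Real.rpow_add hn']; congr 2; ring

lemma Sparse.pow_mul_gain_mul_pow_le {r : Finset (Fin k) → ℕ} {Y : Set (Fin k → ℤ)}
    (hY : Sparse D r Y) (hn : 1 ≤ n) (hp0 : 0 ≤ p) (hc : 0 ≤ c)
    (hp : p ≤ c * (n : ℝ) ^ (-expo k D)) {W : Finset (Fin k)} (h1 : 1 ≤ W.card)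
    (hk : W.card < k) :
    (n : ℝ) ^ (D - r W) * ((n : ℝ) ^ gainExp k D W.card * p ^ (k - W.card)) ≤
      c ^ (k - W.card) := by
  have hn1 : (1 : ℝ) ≤ n := by exact_mod_cast hn
  have hn0 : (0 : ℝ) < n := by linarith
  have hexp : ((D - r W : ℕ) : ℝ) - expo k D * (k - W.card : ℕ) + gainExp k D W.card ≤ 0 := by
    rw [Nat.cast_sub (hY.le W), Nat.cast_sub hk.le]
    linear_combination hY.expo_mul_add_gainExp_le h1 hk - expo_mul (k := k) (D := D) (by omega)
  calc _ = (n : ℝ) ^ (D - r W) * p ^ (k - W.card) * (n : ℝ) ^ gainExp k D W.card := by ring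
    _ ≤ c ^ (k - W.card) * (n : ℝ) ^ (((D - r W : ℕ) : ℝ) - expo k D * (k - W.card : ℕ)) *
          (n : ℝ) ^ gainExp k D W.card := by
        gcongr ?_ * _
        exact pow_mul_pow_le hn hp0 hp _ _
    _ = c ^ (k - W.card) *
          (n : ℝ) ^ (((D - r W : ℕ) : ℝ) - expo k D * (k - W.card : ℕ) + gainExp k D W.card) := by
        rw [Real.rpow_add hn0, mul_assoc]
    _ ≤ c ^ (k - W.card) := mul_le_of_le_one_right (by positivity)
        (Real.rpow_le_one_of_one_le_of_nonpos hn1 hexp)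

lemma sum_edges_pow_le (hk : k ≠ 1) (hY : ∀ i, Sparse D (r i) (Y i)) (hn : 1 ≤ n) (hp0 : 0 ≤ p)
    (hc0 : 0 ≤ c) (hc1 : c ≤ 1) (hp : p ≤ c * (n : ℝ) ^ (-expo k D)) :
    ∑ e ∈ edges Y n, p ^ e.card ≤ 2 * (n : ℝ) ^ (1 - expo k D) := by
  have hcard : ((edges Y n).card : ℝ) ≤ 2 * (n : ℝ) ^ D := by exact_mod_cast card_edges_le hY hn
  calc ∑ e ∈ edges Y n, p ^ e.card = (edges Y n).card * p ^ k := by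
        rw [Finset.sum_congr rfl fun e he => by rw [card_of_mem_edges he], Finset.sum_const,
          nsmul_eq_mul]
    _ ≤ 2 * (n : ℝ) ^ D * p ^ k := by gcongr
    _ = 2 * ((n : ℝ) ^ D * p ^ k) := by ring
    _ ≤ 2 * (c ^ k * (n : ℝ) ^ ((D : ℝ) - expo k D * k)) := by
        gcongr 2 * ?_
        exact pow_mul_pow_le hn hp0 hp _ _
    _ ≤ 2 * (1 * (n : ℝ) ^ ((D : ℝ) - expo k D * k)) := by
        gcongr
        exact pow_le_one₀ hc0 hc1
    _ = 2 * (n : ℝ) ^ (1 - expo k D) := by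
        rw [one_mul, show (D : ℝ) - expo k D * k = 1 - expo k D by
          linear_combination -(expo_mul (D := D) hk)]

lemma sum_edges_inter_eq_one_le (hk : 2 ≤ k) (hY : ∀ i, Sparse D (r i) (Y i)) (hn : 1 ≤ n)
    (hp0 : 0 ≤ p) (hc0 : 0 ≤ c) (hc1 : c ≤ 1) (hp : p ≤ c * (n : ℝ) ^ (-expo k D))
    (X : Finset ℤ) :
    ∑ f ∈ edges Y n with (f ∩ X).card = 1, p ^ (k - 1) ≤ 2 * (k * (X.card * c)) := by
  have hterm : ∀ i, ∀ W : Finset (Fin k), (X.card : ℝ) ^ W.card * (n : ℝ) ^ (D - r i W) *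
      (if W.card = 1 then p ^ (k - 1) else 0) ≤ if W.card = 1 then X.card * c else 0 := by
    intro i W
    split_ifs with hW
    · have h := (hY i).pow_mul_gain_mul_pow_le hn hp0 hc0 hp hW.ge (by omega)
      rw [hW, gainExp, if_pos rfl, Real.rpow_zero, one_mul] at h
      rw [hW, pow_one, mul_assoc]
      gcongr
      exact h.trans (pow_le_of_le_one hc0 hc1 (by omega))
    · simp
  have hcard : (Finset.univ.filter fun W : Finset (Fin k) => W.card = 1).card = k := by
    rw [Finset.univ_filter_card_eq, Finset.card_powersetCard, Finset.card_univ,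
      Fintype.card_fin, Nat.choose_one_right]
  calc _ ≤ ∑ i, ∑ W : Finset (Fin k), (X.card : ℝ) ^ W.card * (n : ℝ) ^ (D - r i W) *
        (if W.card = 1 then p ^ (k - 1) else 0) := by
        rw [Finset.sum_filter]
        exact sum_edges_le hY hn X (φ := fun w => if w = 1 then p ^ (k - 1) else 0)
          fun w => by positivity
    _ ≤ ∑ _i : Fin 2, ∑ W : Finset (Fin k), (if W.card = 1 then X.card * c else 0) :=
        Finset.sum_le_sum fun i _ => Finset.sum_le_sum fun W _ => hterm i W
    _ = 2 * (k * (X.card * c)) := by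
        rw [← Finset.sum_filter, Finset.sum_const, Finset.sum_const, hcard]
        simp

lemma sum_edges_inter_lt_le (hY : ∀ i, Sparse D (r i) (Y i)) (hn : 1 ≤ n) (hp0 : 0 ≤ p)
    (hc0 : 0 ≤ c) (hc1 : c ≤ 1) (hp : p ≤ c * (n : ℝ) ^ (-expo k D)) {X : Finset ℤ}
    (hX : X.Nonempty) :
    ∑ f ∈ edges Y n with 1 ≤ (f ∩ X).card ∧ (f ∩ X).card < k,
      (n : ℝ) ^ gainExp k D (f ∩ X).card * p ^ (k - (f ∩ X).card) ≤
        2 ^ (k + 1) * (X.card : ℝ) ^ k := by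
  have hX1 : (1 : ℝ) ≤ X.card := by exact_mod_cast hX.card_pos
  let φ : ℕ → ℝ := fun w =>
    if 1 ≤ w ∧ w < k then (n : ℝ) ^ gainExp k D w * p ^ (k - w) else 0
  have hterm : ∀ i, ∀ W : Finset (Fin k), (X.card : ℝ) ^ W.card * (n : ℝ) ^ (D - r i W) *
      φ W.card ≤ (X.card : ℝ) ^ k := by
    intro i W
    simp only [φ]
    split_ifs with hW
    · rw [mul_assoc]
      calc _ ≤ (X.card : ℝ) ^ W.card * 1 := by
            gcongr
            exact ((hY i).pow_mul_gain_mul_pow_le hn hp0 hc0 hp hW.1 hW.2).trans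
              (pow_le_one₀ hc0 hc1)
        _ ≤ (X.card : ℝ) ^ k := by
            rw [mul_one]; exact pow_le_pow_right₀ hX1 hW.2.le
    · rw [mul_zero]; positivity
  calc _ ≤ ∑ i, ∑ W : Finset (Fin k), (X.card : ℝ) ^ W.card * (n : ℝ) ^ (D - r i W) *
        φ W.card := by
        rw [Finset.sum_filter]
        exact sum_edges_le hY hn X (φ := φ) fun w => by positivity
    _ ≤ ∑ _i : Fin 2, ∑ _W : Finset (Fin k), (X.card : ℝ) ^ k :=
        Finset.sum_le_sum fun i _ => Finset.sum_le_sum fun W _ => hterm i W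
    _ = 2 ^ (k + 1) * (X.card : ℝ) ^ k := by
        simp only [Finset.sum_const, Finset.card_univ, Fintype.card_finset, Fintype.card_fin,
          nsmul_eq_mul]
        push_cast
        ring

lemma degreeBounds_edges (hk : 2 ≤ k) (hY : ∀ i, Sparse D (r i) (Y i)) (hn : 1 ≤ n)
    (hp0 : 0 ≤ p) (hp : p ≤ 1 / (4 * (k : ℝ) ^ 2) * (n : ℝ) ^ (-expo k D)) :
    DegreeBounds (edges Y n) k p (fun w => (n : ℝ) ^ gainExp k D w) (2 ^ (k + 1)) := by
  have hk2 : (2 : ℝ) ≤ k := by exact_mod_cast hk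
  have hc0 : (0 : ℝ) ≤ 1 / (4 * (k : ℝ) ^ 2) := by positivity
  have hc1 : 1 / (4 * (k : ℝ) ^ 2) ≤ 1 := by
    rw [div_le_one (by positivity)]
    nlinarith
  constructor
  case uniform => exact fun e he => card_of_mem_edges he
  case sum_le =>
    simpa [gainExp] using sum_edges_pow_le (by omega) hY hn hp0 hc0 hc1 hp
  case sum_inter_eq_one_le =>
    intro e he
    refine (sum_edges_inter_eq_one_le hk hY hn hp0 hc0 hc1 hp e).trans (le_of_eq ?_)
    rw [card_of_mem_edges he]
    field_simp
    norm_num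
  case sum_inter_lt_le => exact fun X hX => sum_edges_inter_lt_le hY hn hp0 hc0 hc1 hp hX

end Solutions

section Threshold

variable {k D : ℕ} {r : Fin 2 → Finset (Fin k) → ℕ} {Y : Fin 2 → Set (Fin k → ℤ)}

/-- Every two-colouring of `S` has, for some `i`, an injective member of `Y i` in `S` all of whose
coordinates have colour `i`. -/
def Unavoidable (Y : Fin 2 → Set (Fin k → ℤ)) (S : Set ℤ) : Prop :=
  ∀ χ : ℤ → Fin 2, ∃ i, ∃ y ∈ Y i, Function.Injective y ∧ (∀ j, y j ∈ S) ∧ ∀ j, χ (y j) = i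

lemma Unavoidable.exists_critical (hk : 1 ≤ k) {n : ℕ} {S : Set ℤ} (hS : S ⊆ Set.Icc 1 (n : ℤ))
    (h : Unavoidable Y S) : ∃ E' ⊆ inducedEdges (edges Y n) S, Critical E' k := by
  classical
  let F : Finset (Fin 2 × Finset ℤ) := {x ∈ Finset.univ ×ˢ edges Y n | (x.2 : Set ℤ) ⊆ S}
  have mem_F {i e} : (i, e) ∈ F ↔ e ∈ inducedEdges (edges Y n) S := by
    simp [F, inducedEdges]
  have hF : ForcesMonochromatic F := by
    intro χ
    obtain ⟨i, y, hy, hinj, hyS, hχ⟩ := h χ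
    refine ⟨(i, Finset.univ.image y), mem_F.2 ⟨mem_edges.2 ⟨i, y, ?_, rfl⟩, ?_⟩, ?_⟩
    · exact mem_solutions.2 ⟨fun j => hS (hyS j), hinj, hy⟩
    · simpa [Set.range_subset_iff] using hyS
    · simpa using hχ
  obtain ⟨E', hE', hcrit⟩ := hF.exists_critical hk fun x hx => card_of_mem_edges (mem_F.1 hx).1
  exact ⟨E', fun e he => let ⟨_, hi⟩ := hE' e he; mem_F.1 hi, hcrit⟩

lemma measureReal_unavoidable_le (hk : 3 ≤ k) (hDk : D < k) (hY : ∀ i, Sparse D (r i) (Y i))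
    {n : ℕ} (hn : 1 ≤ n) (p : I)
    (hp : (p : ℝ) ≤ 1 / (4 * (k : ℝ) ^ 2) * (n : ℝ) ^ (-expo k D)) (T : ℕ) :
    (setBernoulli (Set.Icc (1 : ℤ) n) p).real {S | Unavoidable Y S} ≤
      2 * (n : ℝ) ^ (1 - expo k D) * (1 / 2) ^ T +
      (2 * T + 2) * (2 * (2 * (2 ^ (k + 1) * ((k : ℝ) * (2 * T + 2)) ^ k)) ^ 3 /
        (n : ℝ) ^ (1 / ((k : ℝ) - 1))) := by
  have hn1 : (1 : ℝ) ≤ n := by exact_mod_cast hn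
  have hbound := (degreeBounds_edges (by omega) hY hn p.2.1 hp).measureReal_exists_critical_le
    (γ := (n : ℝ) ^ (1 / ((k : ℝ) - 1))) (Set.Icc (1 : ℤ) n) hk (fun i => by positivity)
    (by simp [gainExp]) (by positivity)
    (fun i hi => Real.rpow_le_rpow_of_exponent_le hn1 (one_div_le_gainExp (by omega) hDk hi))
    (one_le_pow₀ one_le_two) T
  have hgain : gainExp k D 2 = 1 - expo k D := by simp [gainExp]
  rw [hgain] at hbound
  refine le_trans ?_ hbound
  rw [measureReal_def, setBernoulli_apply_eq_apply_subsets, ← measureReal_def]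
  exact measureReal_mono fun S hS => hS.1.exists_critical (by omega) hS.2

lemma clog_two_le_two_mul_log_add_one {n : ℕ} (hn : 1 ≤ n) :
    (Nat.clog 2 n : ℝ) ≤ 2 * Real.log n + 1 := by
  have hlog : 0 ≤ Real.log n := Real.log_nonneg (by exact_mod_cast hn)
  have hlogb : Real.logb 2 n ≤ 2 * Real.log n := by
    have := Real.log_two_gt_d9
    rw [Real.logb, div_le_iff₀ (by linarith)]
    nlinarith
  rw [← Real.natCeil_logb_natCast]
  have hlogb0 : 0 ≤ Real.logb 2 n := Real.logb_nonneg one_lt_two (by exact_mod_cast hn)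
  have hceil := Nat.ceil_lt_add_one hlogb0
  push_cast
  linarith

lemma tendsto_clog_pow_div_rpow (q : ℕ) {ε : ℝ} (hε : 0 < ε) :
    Tendsto (fun n : ℕ => (2 * (Nat.clog 2 n : ℝ) + 2) ^ q / (n : ℝ) ^ ε) atTop (𝓝 0) := by
  have hlog : Tendsto (fun n : ℕ => 8 ^ q * (Real.log n ^ (q : ℝ) / (n : ℝ) ^ ε)) atTop (𝓝 0) := by
    simpa using (((isLittleO_log_rpow_rpow_atTop q hε).tendsto_div_nhds_zero).comp
      tendsto_natCast_atTop_atTop).const_mul ((8 : ℝ) ^ q)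
  refine squeeze_zero' (Eventually.of_forall fun n => by positivity) ?_ hlog
  filter_upwards [eventually_ge_atTop 1,
    (Real.tendsto_log_atTop.comp tendsto_natCast_atTop_atTop).eventually_ge_atTop 1] with n hn hlog1
  have hclog : 2 * (Nat.clog 2 n : ℝ) + 2 ≤ 8 * Real.log n := by
    have := clog_two_le_two_mul_log_add_one hn
    simp only [Function.comp_apply] at hlog1
    linarith
  rw [Real.rpow_natCast, ← mul_div_assoc, ← mul_pow]
  gcongr

theorem tendsto_unavoidable (hD : 2 ≤ D) (hDk : D < k) (hY : ∀ i, Sparse D (r i) (Y i))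
    (p : ℕ → I)
    (hp : ∀ᶠ n : ℕ in atTop, (p n : ℝ) ≤ 1 / (4 * (k : ℝ) ^ 2) * (n : ℝ) ^ (-expo k D)) :
    Tendsto (fun n : ℕ => (setBernoulli (Set.Icc (1 : ℤ) n) (p n)).real {S | Unavoidable Y S})
      atTop (𝓝 0) := by
  have hk1 : (0 : ℝ) < (k : ℝ) - 1 := sub_pos.2 (by exact_mod_cast (by omega : 1 < k))
  have hlim1 : Tendsto (fun n : ℕ => 2 * (n : ℝ) ^ (-expo k D)) atTop (𝓝 0) := by
    simpa using ((tendsto_rpow_neg_atTop (expo_pos hD hDk)).comp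
      tendsto_natCast_atTop_atTop).const_mul (2 : ℝ)
  have hlim2 := (tendsto_clog_pow_div_rpow (3 * k + 1) (one_div_pos.2 hk1)).const_mul
    (2 * (2 * (2 ^ (k + 1) * (k : ℝ) ^ k)) ^ 3)
  have hlim := hlim1.add hlim2
  rw [mul_zero, add_zero] at hlim
  refine squeeze_zero' (Eventually.of_forall fun n => measureReal_nonneg) ?_ hlim
  filter_upwards [hp, eventually_ge_atTop 1] with n hpn hn
  refine (measureReal_unavoidable_le (by omega) hDk hY hn (p n) hpn (Nat.clog 2 n)).trans ?_
  have hn0 : (0 : ℝ) < n := by exact_mod_cast hn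
  have hhalf : ((1 : ℝ) / 2) ^ Nat.clog 2 n ≤ (n : ℝ)⁻¹ := by
    rw [one_div, inv_pow]
    exact inv_anti₀ hn0 (by exact_mod_cast Nat.le_pow_clog one_lt_two n)
  refine add_le_add ?_ (le_of_eq ?_)
  · calc _ ≤ 2 * (n : ℝ) ^ (1 - expo k D) * (n : ℝ)⁻¹ := by gcongr
      _ = 2 * (n : ℝ) ^ (-expo k D) := by
        rw [← Real.rpow_neg_one, mul_assoc, ← Real.rpow_add hn0]
        congr 2
        ring
  · rw [mul_pow (k : ℝ)]
    generalize 2 * (Nat.clog 2 n : ℝ) + 2 = x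
    ring

end Threshold

/-! ### Ranks of coordinate projections -/

section Projection

lemma finrank_map_add_finrank_inf_ker {K E F : Type*} [Field K] [AddCommGroup E] [Module K E]
    [AddCommGroup F] [Module K F] [FiniteDimensional K E] (f : E →ₗ[K] F) (V : Submodule K E) :
    finrank K (V.map f) + finrank K (V ⊓ LinearMap.ker f : Submodule K E) = finrank K V := by
  have h := LinearMap.finrank_range_add_finrank_ker (f.domRestrict V)
  rwa [LinearMap.range_domRestrict, LinearMap.ker_domRestrict,
    ← Submodule.finrank_map_subtype_eq, Submodule.map_comap_subtype] at h

variable {K : Type*} [Field K] {ι : Type*}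

variable (K) in
/-- The linear map forgetting the coordinates outside `W`. -/
def restrict (W : Finset ι) : (ι → K) →ₗ[K] ({j // j ∈ W} → K) :=
  LinearMap.funLeft K K Subtype.val

lemma mem_ker_restrict {W : Finset ι} {x : ι → K} :
    x ∈ LinearMap.ker (restrict K W) ↔ ∀ j ∈ W, x j = 0 := by
  simp [restrict, funext_iff, LinearMap.funLeft_apply]

/-- The dimension of the projection of `V` to the coordinates in `W`. -/
def projRank (V : Submodule K (ι → K)) (W : Finset ι) : ℕ :=
  finrank K (V.map (restrict K W))

lemma one_le_projRank {V : Submodule K (ι → K)} {W : Finset ι} {x : ι → K} (hx : x ∈ V) {j : ι}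
    (hj : j ∈ W) (hxj : x j ≠ 0) : 1 ≤ projRank V W := by
  rw [projRank, Nat.one_le_iff_ne_zero, Ne, Submodule.finrank_eq_zero]
  intro h
  have hmem : restrict K W x ∈ V.map (restrict K W) := Submodule.mem_map_of_mem hx
  rw [h, Submodule.mem_bot] at hmem
  exact hxj (mem_ker_restrict.1 hmem j hj)

lemma mul_eq_mul_of_projRank_le_one {V : Submodule K (ι → K)} {W : Finset ι}
    (hV : projRank V W ≤ 1) {x y : ι → K} (hx : x ∈ V) (hy : y ∈ V) {i j : ι}
    (hi : i ∈ W) (hj : j ∈ W) : y i * x j = y j * x i := by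
  obtain ⟨v, hv⟩ := finrank_le_one_iff.1 hV
  have coord {z : ι → K} (hz : z ∈ V) : ∃ a, ∀ j (hj : j ∈ W), a * v.1 ⟨j, hj⟩ = z j := by
    obtain ⟨a, ha⟩ := hv ⟨restrict K W z, Submodule.mem_map_of_mem hz⟩
    exact ⟨a, fun j hj => congrFun (congrArg Subtype.val ha) ⟨j, hj⟩⟩
  obtain ⟨a, ha⟩ := coord hx
  obtain ⟨b, hb⟩ := coord hy
  rw [← ha i hi, ← ha j hj, ← hb i hi, ← hb j hj]
  ring

lemma projRank_map_funLeft {κ : Type*} (V : Submodule K (ι → K)) (e : κ ↪ ι) (U : Finset κ) :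
    projRank (V.map (LinearMap.funLeft K K e)) U = projRank V (U.map e) := by
  have h : (V.map (LinearMap.funLeft K K e)).map (restrict K U) =
      (V.map (restrict K (U.map e))).map
        (LinearEquiv.funCongrLeft K K (U.equivMap e)).toLinearMap := by
    rw [← Submodule.map_comp, ← Submodule.map_comp]
    rfl
  rw [projRank, h, projRank]
  exact LinearEquiv.finrank_map_eq _ _

section Finite

variable [Finite ι]

lemma projRank_add_finrank (V : Submodule K (ι → K)) (W : Finset ι) :
    projRank V W + finrank K (V ⊓ LinearMap.ker (restrict K W) : Submodule K (ι → K)) =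
      finrank K V :=
  finrank_map_add_finrank_inf_ker _ V

lemma projRank_le (V : Submodule K (ι → K)) (W : Finset ι) : projRank V W ≤ finrank K V :=
  le_of_add_le_left (projRank_add_finrank V W).le

lemma exists_determining_coordinates (V : Submodule K (ι → K)) :
    ∃ J : Finset ι, J.card ≤ finrank K V ∧ ∀ x ∈ V, (∀ j ∈ J, x j = 0) → x = 0 := by
  classical
  induction hd : finrank K V using Nat.strong_induction_on generalizing V with
  | _ d ih =>
    by_cases hV : V = ⊥
    · exact ⟨∅, by simp, fun x hx _ => by simpa [hV] using hx⟩
    obtain ⟨x, hx, hx0⟩ := Submodule.exists_mem_ne_zero_of_ne_bot hV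
    obtain ⟨j, hj⟩ := Function.ne_iff.1 hx0
    have hlt : V ⊓ LinearMap.ker (restrict K {j}) < V := by
      refine lt_of_le_of_ne inf_le_left fun h => hj ?_
      rw [← h] at hx
      exact mem_ker_restrict.1 hx.2 j (Finset.mem_singleton_self j)
    have hfin := Submodule.finrank_lt_finrank_of_lt hlt
    obtain ⟨J, hJ, hdet⟩ := ih _ (hd ▸ hfin) _ rfl
    refine ⟨insert j J, (Finset.card_insert_le j J).trans (by omega), fun y hy hyJ =>
      hdet y ⟨hy, ?_⟩ fun i hi => hyJ i (Finset.mem_insert_of_mem hi)⟩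
    rw [SetLike.mem_coe, mem_ker_restrict]
    simpa using hyJ j (Finset.mem_insert_self j J)

end Finite

variable [Fintype ι]

lemma projRank_univ (V : Submodule K (ι → K)) : projRank V Finset.univ = finrank K V := by
  have hker : LinearMap.ker (restrict K (Finset.univ : Finset ι)) = ⊥ := by
    rw [LinearMap.ker_eq_bot']
    exact fun x hx => funext fun j => mem_ker_restrict.1 hx j (Finset.mem_univ j)
  rw [← projRank_add_finrank V Finset.univ, hker, inf_bot_eq, finrank_bot, add_zero]

lemma card_add_finrank_ker_restrict (W : Finset ι) :
    W.card + finrank K (LinearMap.ker (restrict K W)) = Fintype.card ι := by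
  have hsurj : LinearMap.range (restrict K W) = ⊤ := LinearMap.range_eq_top.2
    (LinearMap.funLeft_surjective_of_injective K K _ Subtype.val_injective)
  have h := LinearMap.finrank_range_add_finrank_ker (restrict K W)
  rwa [hsurj, finrank_top, finrank_fintype_fun_eq_card, finrank_fintype_fun_eq_card,
    Fintype.card_coe] at h

variable [DecidableEq ι] {m : Type*}

lemma submatrix_mulVec_eq_mulVec (M : Matrix m ι K) {W : Finset ι} {x : ι → K}
    (hx : ∀ j ∈ W, x j = 0) :
    M.submatrix id (Subtype.val : {j // j ∈ Wᶜ} → ι) *ᵥ (fun j => x j) = M *ᵥ x := by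
  ext i
  simp only [mulVec, dotProduct, submatrix_apply, id_eq]
  rw [Finset.sum_coe_sort Wᶜ fun j => M i j * x j]
  refine Finset.sum_subset (Finset.subset_univ _) fun j _ hj => ?_
  rw [hx j (by simpa using hj), mul_zero]

lemma range_mulVecLin_submatrix (M : Matrix m ι K) (W : Finset ι) :
    LinearMap.range (M.submatrix id (Subtype.val : {j // j ∈ Wᶜ} → ι)).mulVecLin =
      (LinearMap.ker (restrict K W)).map M.mulVecLin := by
  ext v
  constructor
  · rintro ⟨y, rfl⟩
    let x : ι → K := fun j => if hj : j ∈ Wᶜ then y ⟨j, hj⟩ else 0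
    have hx : ∀ j ∈ W, x j = 0 := fun j hj => dif_neg (by simpa using hj)
    have hxy : (fun j : {j // j ∈ Wᶜ} => x j) = y := funext fun j => dif_pos j.2
    refine ⟨x, mem_ker_restrict.2 hx, ?_⟩
    rw [mulVecLin_apply, mulVecLin_apply, ← submatrix_mulVec_eq_mulVec M hx, hxy]
  · rintro ⟨x, hx, rfl⟩
    exact ⟨fun j => x j, submatrix_mulVec_eq_mulVec M (mem_ker_restrict.1 hx)⟩

lemma projRank_ker_mulVecLin_add_rank (M : Matrix m ι K) (W : Finset ι) :
    projRank (LinearMap.ker M.mulVecLin) W + M.rank =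
      W.card + (M.submatrix id (Subtype.val : {j // j ∈ Wᶜ} → ι)).rank := by
  have hnullity := LinearMap.finrank_range_add_finrank_ker M.mulVecLin
  have hproj := projRank_add_finrank (LinearMap.ker M.mulVecLin) W
  have hsub := finrank_map_add_finrank_inf_ker M.mulVecLin (LinearMap.ker (restrict K W))
  have hker := card_add_finrank_ker_restrict (K := K) W
  rw [← range_mulVecLin_submatrix, inf_comm] at hsub
  rw [finrank_fintype_fun_eq_card] at hnullity
  rw [Matrix.rank, Matrix.rank]
  omega

end Projection

section CountSolutions

variable {k : ℕ} {V : Submodule ℚ (Fin k → ℚ)} {Y : Set (Fin k → ℤ)}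

/-- Once the coordinates in `W` are fixed, the remaining freedom lies in the kernel of the
projection to `W`, which is determined by `dim V - projRank V W` coordinates. -/
lemma card_solutions_le (hY : ∀ y ∈ Y, ∀ y' ∈ Y, (fun j => (y j : ℚ) - y' j) ∈ V) {n : ℕ}
    (hn : 1 ≤ n) (X : Finset ℤ) (W : Finset (Fin k)) :
    {y ∈ solutions Y n | ∀ j ∈ W, y j ∈ X}.card ≤
      X.card ^ W.card * n ^ (finrank ℚ V - projRank V W) := by
  obtain ⟨J, hJ, hdet⟩ := exists_determining_coordinates (V ⊓ LinearMap.ker (restrict ℚ W))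
  have hrank := projRank_add_finrank V W
  have heq : ∀ y ∈ Y, ∀ y' ∈ Y, (∀ j ∈ W, y j = y' j) → (∀ j ∈ J, y j = y' j) → y = y' := by
    intro y hy y' hy' hW hJ
    have hzero := hdet _ ⟨hY y hy y' hy', mem_ker_restrict.2 fun j hj => by simp [hW j hj]⟩
      fun j hj => by simp [hJ j hj]
    exact funext fun j => by exact_mod_cast sub_eq_zero.1 (congrFun hzero j)
  calc {y ∈ solutions Y n | ∀ j ∈ W, y j ∈ X}.card
      ≤ ((Fintype.piFinset fun _ : {j // j ∈ W} => X) ×ˢ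
          (Fintype.piFinset fun _ : {j // j ∈ J} => Finset.Icc (1 : ℤ) n)).card := by
        refine Finset.card_le_card_of_injOn (fun y => (fun j => y j, fun j => y j)) ?_ ?_
        · intro y hy
          obtain ⟨hsol, hyX⟩ := Finset.mem_filter.1 hy
          exact Finset.mem_product.2 ⟨Fintype.mem_piFinset.2 fun j => hyX j j.2,
            Fintype.mem_piFinset.2 fun j => Finset.mem_Icc.2 ((mem_solutions.1 hsol).1 j)⟩
        · intro y hy y' hy' hyy'
          obtain ⟨hW, hJ⟩ := Prod.mk.inj hyy'
          exact heq y (mem_solutions.1 (Finset.mem_filter.1 hy).1).2.2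
            y' (mem_solutions.1 (Finset.mem_filter.1 hy').1).2.2
            (fun j hj => congrFun hW ⟨j, hj⟩) fun j hj => congrFun hJ ⟨j, hj⟩
    _ = X.card ^ W.card * n ^ J.card := by simp
    _ ≤ X.card ^ W.card * n ^ (finrank ℚ V - projRank V W) := by
        gcongr
        omega

lemma sparse_of_projRank (hY : ∀ y ∈ Y, ∀ y' ∈ Y, (fun j => (y j : ℚ) - y' j) ∈ V) (hk : 2 ≤ k)
    (h1 : ∀ W : Finset (Fin k), W.Nonempty → 1 ≤ projRank V W)
    (h2 : ∀ W : Finset (Fin k), 2 ≤ W.card → 2 ≤ projRank V W)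
    (hb : ∀ W : Finset (Fin k), 2 ≤ W.card → W.card < k →
      ((W.card : ℝ) - 1) / ((projRank V W : ℝ) - 1) < ((k : ℝ) - 1) / ((finrank ℚ V : ℝ) - 1)) :
    Sparse (finrank ℚ V) (projRank V) Y where
  le := projRank_le V
  one_le W hW := h1 W (Finset.card_pos.1 hW.ge)
  two_le W hW := h2 W hW.ge
  balanced W hW hWk := by
    have hD : (2 : ℝ) ≤ finrank ℚ V := by
      rw [← projRank_univ]; exact_mod_cast h2 _ (by simpa using hk)
    have hr : (2 : ℝ) ≤ projRank V W := by exact_mod_cast h2 W hW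
    have h := hb W hW hWk
    rw [div_lt_div_iff₀ (by linarith) (by linarith)] at h
    exact_mod_cast h
  card_le n hn X W := card_solutions_le hY hn X W

end CountSolutions

/-! ### Kernels of integer matrices -/

section Kernel

variable {ℓ k : ℕ} {A : Matrix (Fin ℓ) (Fin k) ℤ}

/-- The rational solutions of `A x = 0`. -/
def ratKer (A : Matrix (Fin ℓ) (Fin k) ℤ) : Submodule ℚ (Fin k → ℚ) :=
  LinearMap.ker (A.map (Int.cast : ℤ → ℚ)).mulVecLin

lemma cast_mem_ratKer_iff {x : Fin k → ℤ} : (fun j => (x j : ℚ)) ∈ ratKer A ↔ A *ᵥ x = 0 := by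
  have hcast : A.map (Int.cast : ℤ → ℚ) *ᵥ (fun j => (x j : ℚ)) = fun i => ((A *ᵥ x) i : ℚ) := by
    ext i
    simp [mulVec, dotProduct]
  rw [ratKer, LinearMap.mem_ker, mulVecLin_apply, hcast, funext_iff, funext_iff]
  simp

lemma rank_map_cast_eq_colRank (A : Matrix (Fin ℓ) (Fin k) ℤ) :
    (A.map (Int.cast : ℤ → ℚ)).rank = colRank A Finset.univ :=
  (rank_submatrix _ (Equiv.refl _) (Equiv.subtypeUnivEquiv Finset.mem_univ)).symm

lemma colRank_add_finrank_ratKer (A : Matrix (Fin ℓ) (Fin k) ℤ) :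
    colRank A Finset.univ + finrank ℚ (ratKer A) = k := by
  rw [← rank_map_cast_eq_colRank, Matrix.rank, ratKer, LinearMap.finrank_range_add_finrank_ker,
    finrank_fintype_fun_eq_card, Fintype.card_fin]

lemma projRank_ratKer_add_colRank (A : Matrix (Fin ℓ) (Fin k) ℤ) (W : Finset (Fin k)) :
    projRank (ratKer A) W + colRank A Finset.univ = W.card + colRank A Wᶜ := by
  rw [← rank_map_cast_eq_colRank]
  exact projRank_ker_mulVecLin_add_rank _ W

lemma exists_prime_padicValInt_ne {a b : ℤ} (ha : 0 < a) (hb : 0 < b) (hab : a ≠ b) :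
    ∃ q : ℕ, q.Prime ∧ padicValInt q a ≠ padicValInt q b := by
  by_contra! h
  have := (Nat.eq_iff_prime_padicValNat_eq a.natAbs b.natAbs (by omega) (by omega)).2 h
  omega

/-- Colour by the `q`-adic valuation modulo `m`, for a prime `q` at which `a` and `b` have different
valuations and `m` large. -/
lemma exists_colouring_separating_ratio {a b : ℤ} (ha : 0 < a) (hb : 0 < b) (hab : a ≠ b) :
    ∃ (r : ℕ) (χ : ℤ → Fin r), ∀ y z : ℤ, 0 < y → 0 < z → y * b = z * a → χ y ≠ χ z := by
  obtain ⟨q, hq, hne⟩ := exists_prime_padicValInt_ne ha hb hab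
  have := Fact.mk hq
  set m := padicValInt q a + padicValInt q b + 1
  refine ⟨m, fun z => ⟨padicValInt q z % m, Nat.mod_lt _ (by omega)⟩, fun y z hy hz h heq => ?_⟩
  have hval := congrArg (padicValInt q) h
  rw [padicValInt.mul hy.ne' hb.ne', padicValInt.mul hz.ne' ha.ne'] at hval
  have hyz : padicValInt q y ≡ padicValInt q z [MOD m] := congrArg Fin.val heq
  have hmod : padicValInt q z + padicValInt q a ≡ padicValInt q z + padicValInt q b [MOD m] := by
    rw [← hval]
    exact hyz.add_right _
  exact hne (Nat.ModEq.eq_of_lt_of_lt (Nat.ModEq.add_left_cancel' _ hmod) (by omega) (by omega))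

lemma one_le_projRank_ratKer (hA : Irredundant A 0) {W : Finset (Fin k)} (hW : W.Nonempty) :
    1 ≤ projRank (ratKer A) W := by
  obtain ⟨x, -, hpos, hx⟩ := hA
  obtain ⟨j, hj⟩ := hW
  exact one_le_projRank (cast_mem_ratKer_iff.2 hx) hj (by exact_mod_cast (hpos j).ne')

lemma two_le_projRank_ratKer (hA : Irredundant A 0) (hPR : PartitionRegular A)
    {W : Finset (Fin k)} (hW : 2 ≤ W.card) : 2 ≤ projRank (ratKer A) W := by
  by_contra! hlt
  obtain ⟨x, hinj, hpos, hx⟩ := hA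
  obtain ⟨i, hi, j, hj, hij⟩ := Finset.one_lt_card.1 hW
  obtain ⟨r, χ, hχ⟩ := exists_colouring_separating_ratio (hpos i) (hpos j) (hinj.ne hij)
  obtain ⟨c, y, hy, hAy⟩ := hPR r χ
  have hratio := mul_eq_mul_of_projRank_le_one (Nat.le_of_lt_succ hlt)
    (cast_mem_ratKer_iff.2 hx) (cast_mem_ratKer_iff.2 hAy) hi hj
  refine hχ (y i) (y j) (hy i).1 (hy j).1 (by exact_mod_cast hratio) ?_
  rw [(hy i).2, (hy j).2]

end Kernel

/-! ### The threshold parameters -/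

section Parameters

variable {ℓ k : ℕ} {A : Matrix (Fin ℓ) (Fin k) ℤ}

/-- The term of `W` in the maximum defining `m(A)`, written with the rank of the projection of the
rational solution space to `W`. -/
def mRatio (A : Matrix (Fin ℓ) (Fin k) ℤ) (W : Finset (Fin k)) : ℝ :=
  ((W.card : ℝ) - 1) / ((projRank (ratKer A) W : ℝ) - 1)

lemma card_sub_one_add_colRank_sub (A : Matrix (Fin ℓ) (Fin k) ℤ) (W : Finset (Fin k)) :
    (W.card : ℝ) - 1 + (colRank A Wᶜ : ℝ) - (colRank A Finset.univ : ℝ) =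
      (projRank (ratKer A) W : ℝ) - 1 := by
  have h : (projRank (ratKer A) W : ℝ) + colRank A Finset.univ = W.card + colRank A Wᶜ :=
    mod_cast projRank_ratKer_add_colRank A W
  linarith

lemma mParam_eq_iSup (A : Matrix (Fin ℓ) (Fin k) ℤ) :
    mParam A = ⨆ W : {W : Finset (Fin k) // 2 ≤ W.card}, mRatio A W.1 := by
  simp only [mParam, mRatio, card_sub_one_add_colRank_sub]

lemma mRatio_le_mParam {W : Finset (Fin k)} (hW : 2 ≤ W.card) : mRatio A W ≤ mParam A := by
  rw [mParam_eq_iSup]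
  exact le_ciSup (f := fun W : {W : Finset (Fin k) // 2 ≤ W.card} => mRatio A W.1)
    (Set.finite_range _).bddAbove ⟨W, hW⟩

lemma exists_mRatio_eq_mParam (A : Matrix (Fin ℓ) (Fin k) ℤ) (hk : 2 ≤ k) :
    ∃ W : Finset (Fin k), 2 ≤ W.card ∧ mRatio A W = mParam A := by
  have : Nonempty {W : Finset (Fin k) // 2 ≤ W.card} := ⟨⟨Finset.univ, by simpa using hk⟩⟩
  obtain ⟨W, hW⟩ := exists_eq_ciSup_of_finite
    (f := fun W : {W : Finset (Fin k) // 2 ≤ W.card} => mRatio A W.1)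
  exact ⟨W.1, W.2, hW.trans (mParam_eq_iSup A).symm⟩

lemma mRatio_univ (A : Matrix (Fin ℓ) (Fin k) ℤ) :
    mRatio A Finset.univ = ((k : ℝ) - 1) / ((finrank ℚ (ratKer A) : ℝ) - 1) := by
  rw [mRatio, projRank_univ, Finset.card_univ, Fintype.card_fin]

lemma FullRank.add_finrank_ratKer (hA : FullRank A) : ℓ + finrank ℚ (ratKer A) = k := by
  rw [FullRank] at hA
  simpa only [hA] using colRank_add_finrank_ratKer A

lemma FullRank.mRatio_univ (hA : FullRank A) :
    mRatio A Finset.univ = ((k : ℝ) - 1) / ((k : ℝ) - 1 - (ℓ : ℝ)) := by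
  have hk : (ℓ : ℝ) + finrank ℚ (ratKer A) = k := mod_cast hA.add_finrank_ratKer
  rw [RandomRado.mRatio_univ, ← hk]
  ring_nf

lemma StrictlyBalanced.mRatio_lt_mRatio_univ (hA : StrictlyBalanced A) (hf : FullRank A)
    {W : Finset (Fin k)} (hW : 2 ≤ W.card) (hWk : W.card < k) :
    mRatio A W < mRatio A Finset.univ := by
  have hrank := card_sub_one_add_colRank_sub A W
  rw [show colRank A Finset.univ = ℓ from hf] at hrank
  rw [hf.mRatio_univ, mRatio, ← hrank]
  exact hA W hW hWk

lemma StrictlyBalanced.mParam_eq_mRatio_univ (hA : StrictlyBalanced A) (hf : FullRank A)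
    (hk : 2 ≤ k) : mParam A = mRatio A Finset.univ := by
  apply le_antisymm
  · obtain ⟨W, hW, hWm⟩ := exists_mRatio_eq_mParam A hk
    rw [← hWm]
    rcases eq_or_ne W Finset.univ with rfl | hne
    · exact le_rfl
    · refine (hA.mRatio_lt_mRatio_univ hf hW ?_).le
      simpa using (Finset.card_lt_iff_ne_univ W).2 hne
  · exact mRatio_le_mParam (by simpa using hk)

lemma projRank_ratKer_sub_one_pos (hA : Irredundant A 0) (hPR : PartitionRegular A)
    {W : Finset (Fin k)} (hW : 2 ≤ W.card) : 0 < (projRank (ratKer A) W : ℝ) - 1 :=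
  sub_pos.2 (mod_cast two_le_projRank_ratKer hA hPR hW)

/-- For `m > 0`, the inequalities `w / (r + 1 / m) ≤ m` and `(w - 1) / r ≤ m` are equivalent, and so
are the corresponding equalities. -/
lemma mPair_eq_of_mParam_eq {ℓB kB : ℕ} {B : Matrix (Fin ℓB) (Fin kB) ℤ} {m : ℝ} (hk : 2 ≤ k)
    (hA : Irredundant A 0) (hPR : PartitionRegular A) (hm : 0 < m)
    (hmA : mParam A = m) (hmB : mParam B = m) : mPair A B = m := by
  have : Nonempty {W : Finset (Fin k) // 2 ≤ W.card} := ⟨⟨Finset.univ, by simpa using hk⟩⟩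
  simp only [mPair, card_sub_one_add_colRank_sub, hmB]
  apply le_antisymm
  · refine ciSup_le fun ⟨W, hW⟩ => ?_
    have hpos := projRank_ratKer_sub_one_pos hA hPR hW
    have hle := hmA ▸ mRatio_le_mParam (A := A) hW
    rw [mRatio, div_le_iff₀ hpos] at hle
    rw [div_le_iff₀ (by positivity), mul_add, mul_one_div_cancel hm.ne']
    linarith
  · obtain ⟨W, hW, hWm⟩ := exists_mRatio_eq_mParam A hk
    have hpos := projRank_ratKer_sub_one_pos hA hPR hW
    rw [hmA, mRatio, div_eq_iff hpos.ne'] at hWm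
    refine le_trans (le_of_eq ?_) (le_ciSup (f := fun W : {W : Finset (Fin k) // 2 ≤ W.card} =>
      (W.1.card : ℝ) / ((projRank (ratKer A) W.1 : ℝ) - 1 + 1 / m))
      (Set.finite_range _).bddAbove ⟨W, hW⟩)
    rw [eq_div_iff (by positivity), mul_add, mul_one_div_cancel hm.ne']
    linarith

end Parameters

/-! ### Cores -/

section Core

variable {ℓA kA ℓ k : ℕ} {A : Matrix (Fin ℓA) (Fin kA) ℤ} {C : Matrix (Fin ℓ) (Fin k) ℤ}

lemma IsCore.exists_embedding (h : IsCore A C) :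
    ∃ e : Fin k ↪ Fin kA, ∀ x, A *ᵥ x = 0 → C *ᵥ (x ∘ e) = 0 := by
  obtain ⟨e, P, hPe, hP0⟩ := h.obtained
  refine ⟨e.toEmbedding, fun x hx => ?_⟩
  have hPx : (P * A.map (Int.cast : ℤ → ℚ)) *ᵥ (fun j => (x j : ℚ)) = 0 := by
    rw [← mulVec_mulVec, show A.map (Int.cast : ℤ → ℚ) *ᵥ (fun j => (x j : ℚ)) = 0 from
      cast_mem_ratKer_iff.2 hx, mulVec_zero]
  rw [← cast_mem_ratKer_iff, ratKer, LinearMap.mem_ker, mulVecLin_apply, ← hPx]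
  ext i
  simp only [mulVec, dotProduct]
  refine Fintype.sum_of_injective e e.injective _ _ (fun j hj => ?_) fun j => ?_
  · rw [hP0 i j hj, zero_mul]
  · rw [hPe i j]
    rfl

lemma IsCore.le_cols (h : IsCore A C) : k ≤ kA := by
  obtain ⟨e, -⟩ := h.exists_embedding
  simpa using Fintype.card_le_of_embedding e

lemma IsCore.partitionRegular (h : IsCore A C) (hPR : PartitionRegular A) :
    PartitionRegular C := by
  obtain ⟨e, he⟩ := h.exists_embedding
  intro r χ
  obtain ⟨c, x, hx, hAx⟩ := hPR r χ
  exact ⟨c, x ∘ e, fun j => hx (e j), he x hAx⟩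

lemma IsCore.mParam_eq_div (h : IsCore A C) (hk : 2 ≤ k) :
    mParam A = ((k : ℝ) - 1) / ((k : ℝ) - 1 - (ℓ : ℝ)) := by
  rw [← h.mParam_eq, h.strictlyBalanced.mParam_eq_mRatio_univ h.fullRank hk, h.fullRank.mRatio_univ]

lemma one_div_mPair_eq {ℓB kB : ℕ} {B : Matrix (Fin ℓB) (Fin kB) ℤ}
    {CB : Matrix (Fin ℓ) (Fin k) ℤ} (hA : Irredundant A 0) (hPR : PartitionRegular A)
    (hC : IsCore A C) (hCB : IsCore B CB) (hk : ℓ + 2 ≤ k) :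
    1 / mPair A B = ((k : ℝ) - ℓ - 1) / ((k : ℝ) - 1) := by
  have hk' : (ℓ : ℝ) + 2 ≤ k := mod_cast hk
  have hkA := hC.le_cols
  rw [mPair_eq_of_mParam_eq (by omega) hA hPR (div_pos (by linarith) (by linarith))
    (hC.mParam_eq_div (by omega)) (hCB.mParam_eq_div (by omega)), one_div_div, sub_right_comm]

end Core

/-! ### Systems with a sparse projection -/

section SparseProjection

/-- Restricting the solutions of `A` to suitable `k` coordinates gives a sparse family. -/
def HasSparseProjection (A : LinearSystem) (k D : ℕ) : Prop :=
  ∃ (e : Fin k ↪ Fin A.cols) (r : Finset (Fin k) → ℕ),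
    Sparse D r ((fun x => x ∘ e) '' {x | A.mat *ᵥ x = A.rhs})

lemma IsCore.hasSparseProjection {A : LinearSystem} {ℓ k : ℕ} {C : Matrix (Fin ℓ) (Fin k) ℤ}
    (h : IsCore A.mat C) (hPR : PartitionRegular A.mat) (hk : 2 ≤ k) :
    HasSparseProjection A k (k - ℓ) := by
  obtain ⟨e, he⟩ := h.exists_embedding
  have hfr := h.fullRank.add_finrank_ratKer
  refine ⟨e, projRank (ratKer C), ?_⟩
  rw [show k - ℓ = finrank ℚ (ratKer C) by omega]
  refine sparse_of_projRank ?_ hk (fun W hW => one_le_projRank_ratKer h.irredundant hW)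
    (fun W hW => two_le_projRank_ratKer h.irredundant (h.partitionRegular hPR) hW)
    fun W hW hWk => mRatio_univ C ▸ h.strictlyBalanced.mRatio_lt_mRatio_univ h.fullRank hW hWk
  rintro _ ⟨x, hx, rfl⟩ _ ⟨x', hx', rfl⟩
  have hsub : A.mat *ᵥ (x - x') = 0 := by rw [mulVec_sub, hx, hx', sub_self]
  simpa using cast_mem_ratKer_iff.2 (he _ hsub)

/-- A `2`-colouring is in particular an `R`-colouring, so only the first two systems matter. -/
lemma tendsto_radoProb_of_hasSparseProjection {k D R : ℕ} (hD : 2 ≤ D) (hDk : D < k) (hR : 2 ≤ R)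
    {A : Fin R → LinearSystem} (hA : ∀ i : Fin 2, HasSparseProjection (A (Fin.castLE hR i)) k D)
    (hpos : ∀ i, 0 < (A i).cols) {p : ℕ → I}
    (hp : ∀ᶠ n : ℕ in atTop, (p n : ℝ) ≤ 1 / (4 * (k : ℝ) ^ 2) * (n : ℝ) ^ (-expo k D)) :
    Tendsto (fun n => radoProb A n (p n)) atTop (𝓝 0) := by
  choose e r hsparse using hA
  refine squeeze_zero (fun n => measureReal_nonneg) (fun n => measureReal_mono ?_)
    (tendsto_unavoidable hD hDk hsparse p hp)
  intro S hS χ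
  obtain ⟨i, x, ⟨hinj, hxS, hx⟩, hχ⟩ := hS fun z => Fin.castLE hR (χ z)
  obtain ⟨i, rfl⟩ : ∃ i' : Fin 2, Fin.castLE hR i' = i := ⟨_, hχ ⟨0, hpos i⟩⟩
  exact ⟨i, x ∘ e i, ⟨x, hx, rfl⟩, hinj.comp (e i).injective, fun j => hxS _,
    fun j => Fin.castLE_injective hR (hχ (e i j))⟩

theorem tendsto_radoProb_pair {k ℓ : ℕ} (hℓ : 1 ≤ ℓ) (hk : ℓ + 2 ≤ k) {A B : LinearSystem}
    (hPA : PartitionRegular A.mat) (hPB : PartitionRegular B.mat)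
    {CA CB : Matrix (Fin ℓ) (Fin k) ℤ} (hCA : IsCore A.mat CA) (hCB : IsCore B.mat CB)
    {p : ℕ → I} (hp : ∀ᶠ n : ℕ in atTop,
      (p n : ℝ) ≤ 1 / (4 * (k : ℝ) ^ 2) * (n : ℝ) ^ (-(((k : ℝ) - ℓ - 1) / ((k : ℝ) - 1)))) :
    Tendsto (fun n => radoProb ![A, B] n (p n)) atTop (𝓝 0) := by
  have hcolsA := hCA.le_cols
  have hcolsB := hCB.le_cols
  refine tendsto_radoProb_of_hasSparseProjection (k := k) (D := k - ℓ) (by omega) (by omega) le_rfl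
    (Fin.forall_fin_two.2 ⟨hCA.hasSparseProjection hPA (by omega),
      hCB.hasSparseProjection hPB (by omega)⟩)
    (Fin.forall_fin_two.2 ⟨(by omega : 0 < A.cols), (by omega : 0 < B.cols)⟩) ?_
  rwa [expo, Nat.cast_sub (by omega)]

variable {ℓ k : ℕ} {A : Matrix (Fin ℓ) (Fin k) ℤ}

lemma two_le_cols (hA : Irredundant A 0) (hrank : 0 < colRank A Finset.univ) : 2 ≤ k := by
  have hnullity := colRank_add_finrank_ratKer A
  have hker := one_le_projRank_ratKer hA (W := Finset.univ)
    (Finset.univ_nonempty_iff.2 ⟨⟨0, by omega⟩⟩)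
  rw [projRank_univ] at hker
  omega

lemma exists_minimal_maximiser (A : Matrix (Fin ℓ) (Fin k) ℤ) (hk : 2 ≤ k) :
    ∃ W : Finset (Fin k), 2 ≤ W.card ∧ mRatio A W = mParam A ∧
      ∀ U : Finset (Fin k), 2 ≤ U.card → U.card < W.card → mRatio A U < mRatio A W := by
  obtain ⟨W, ⟨hW, hWm⟩, hmin⟩ := WellFounded.has_min (measure (Finset.card (α := Fin k))).wf
    {W | 2 ≤ W.card ∧ mRatio A W = mParam A} (exists_mRatio_eq_mParam A hk)
  refine ⟨W, hW, hWm, fun U hU hUW => ?_⟩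
  rw [hWm]
  exact (mRatio_le_mParam hU).lt_of_ne fun hUm => hmin U ⟨hU, hUm⟩ hUW

lemma projRank_ratKer_lt_card (hA : Irredundant A 0) (hPR : PartitionRegular A)
    (hrank : 0 < colRank A Finset.univ) {W : Finset (Fin k)} (hW : 2 ≤ W.card)
    (hWm : mRatio A W = mParam A) : projRank (ratKer A) W < W.card := by
  have huniv : 2 ≤ (Finset.univ : Finset (Fin k)).card := by simpa using two_le_cols hA hrank
  have hfin : 0 < (finrank ℚ (ratKer A) : ℝ) - 1 :=
    projRank_univ (ratKer A) ▸ projRank_ratKer_sub_one_pos hA hPR huniv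
  have hlt : (finrank ℚ (ratKer A) : ℝ) < k := by
    have := colRank_add_finrank_ratKer A
    exact_mod_cast (by omega : finrank ℚ (ratKer A) < k)
  have hone : 1 < mRatio A W := calc
    1 < mRatio A Finset.univ := by rw [mRatio_univ, one_lt_div hfin]; linarith
    _ ≤ mRatio A W := hWm ▸ mRatio_le_mParam huniv
  rw [mRatio, one_lt_div (projRank_ratKer_sub_one_pos hA hPR hW), sub_lt_sub_iff_right] at hone
  exact_mod_cast hone

lemma hasSparseProjection_of_minimal (hA : Irredundant A 0) (hPR : PartitionRegular A)
    {W : Finset (Fin k)} (hW : 2 ≤ W.card)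
    (hmin : ∀ U : Finset (Fin k), 2 ≤ U.card → U.card < W.card → mRatio A U < mRatio A W) :
    HasSparseProjection ⟨ℓ, k, A, 0⟩ W.card (projRank (ratKer A) W) := by
  let e : Fin W.card ↪ Fin k := (W.orderEmbOfFin rfl).toEmbedding
  let V := (ratKer A).map (LinearMap.funLeft ℚ ℚ e)
  have hproj (U) : projRank V U = projRank (ratKer A) (U.map e) := projRank_map_funLeft _ e U
  have hfin : finrank ℚ V = projRank (ratKer A) W := by
    rw [← projRank_univ, hproj, Finset.map_orderEmbOfFin_univ W rfl]
  refine ⟨e, projRank V, hfin ▸ sparse_of_projRank ?_ hW ?_ ?_ ?_⟩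
  · rintro _ ⟨x, hx, rfl⟩ _ ⟨x', hx', rfl⟩
    have hsub : A *ᵥ (x - x') = 0 := by rw [mulVec_sub, hx, hx', sub_self]
    refine ⟨_, cast_mem_ratKer_iff.2 hsub, ?_⟩
    ext j
    simp [LinearMap.funLeft_apply]
  · intro U hU
    rw [hproj]
    exact one_le_projRank_ratKer hA hU.map
  · intro U hU
    rw [hproj]
    exact two_le_projRank_ratKer hA hPR (by rwa [Finset.card_map])
  · intro U hU hUW
    rw [hproj, hfin]
    simpa [mRatio] using hmin (U.map e) (by rwa [Finset.card_map]) (by rwa [Finset.card_map])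

theorem exists_tendsto_radoProb (hA : Irredundant A 0) (hPR : PartitionRegular A)
    (hrank : 0 < colRank A Finset.univ) {R : ℕ} (hR : 2 ≤ R) :
    ∃ c : ℝ, 0 < c ∧ ∀ p : ℕ → I,
      (∀ᶠ n : ℕ in atTop, (p n : ℝ) ≤ c * (n : ℝ) ^ (-(1 / mParam A))) →
      Tendsto (fun n => radoProb (fun _ : Fin R => ⟨ℓ, k, A, 0⟩) n (p n)) atTop (𝓝 0) := by
  have hk := two_le_cols hA hrank
  obtain ⟨W, hW, hWm, hmin⟩ := exists_minimal_maximiser A hk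
  have hexpo : expo W.card (projRank (ratKer A) W) = 1 / mParam A := by
    rw [← hWm, mRatio, expo, one_div_div]
  refine ⟨1 / (4 * (W.card : ℝ) ^ 2), by positivity, fun p hp => ?_⟩
  exact tendsto_radoProb_of_hasSparseProjection (two_le_projRank_ratKer hA hPR hW)
    (projRank_ratKer_lt_card hA hPR hrank hW hWm) hR
    (fun _ => hasSparseProjection_of_minimal hA hPR hW hmin) (fun _ => (by omega : 0 < k))
    (hexpo ▸ hp)

end SparseProjection

end RandomRado

end

theorem theorem1p6 :
    (∀ k ℓ : ℕ, 1 ≤ ℓ → ℓ + 2 ≤ k → ∃ c : ℝ, 0 < c ∧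
      ∀ A B : RandomRado.LinearSystem,
        RandomRado.Irredundant A.mat A.rhs → RandomRado.Irredundant B.mat B.rhs →
        RandomRado.Irredundant A.mat 0 → RandomRado.Irredundant B.mat 0 →
        RandomRado.FullRank A.mat → RandomRado.FullRank B.mat →
        RandomRado.PartitionRegular A.mat → RandomRado.PartitionRegular B.mat →
        ∀ CA CB : Matrix (Fin ℓ) (Fin k) ℤ,
        RandomRado.IsCore A.mat CA → RandomRado.IsCore B.mat CB →
        1 / RandomRado.mPair A.mat B.mat = ((k : ℝ) - ℓ - 1) / ((k : ℝ) - 1) ∧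
        ∀ p : ℕ → unitInterval,
          (∀ᶠ n : ℕ in Filter.atTop,
            (p n : ℝ) ≤ c * (n : ℝ) ^ (-(1 / RandomRado.mPair A.mat B.mat))) →
          Filter.Tendsto (fun n => RandomRado.radoProb ![A, B] n (p n)) Filter.atTop (nhds 0)) ∧
    (∀ (ℓ k : ℕ) (A : Matrix (Fin ℓ) (Fin k) ℤ), 1 ≤ ℓ →
      RandomRado.Irredundant A 0 → RandomRado.PartitionRegular A → RandomRado.FullRank A →
      ∀ r : ℕ, 2 ≤ r → ∃ c : ℝ, 0 < c ∧
        ∀ p : ℕ → unitInterval,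
          (∀ᶠ n : ℕ in Filter.atTop,
            (p n : ℝ) < c * (n : ℝ) ^ (-(1 / RandomRado.mParam A))) →
          Filter.Tendsto (fun n => RandomRado.radoProb (fun _ : Fin r => ⟨ℓ, k, A, 0⟩) n (p n))
            Filter.atTop (nhds 0)) := by
  refine ⟨fun k ℓ hℓ hk => ⟨1 / (4 * (k : ℝ) ^ 2), ?_, ?_⟩, fun ℓ k A hℓ hA hPR hf r hr => ?_⟩
  · have : (0 : ℝ) < k := by exact_mod_cast (by omega : 0 < k)
    positivity
  · intro A B _ _ hA _ _ _ hPA hPB CA CB hCA hCB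
    have hval := RandomRado.one_div_mPair_eq hA hPA hCA hCB hk
    exact ⟨hval, fun p hp => RandomRado.tendsto_radoProb_pair hℓ hk hPA hPB hCA hCB (hval ▸ hp)⟩
  · obtain ⟨c, hc, htendsto⟩ := RandomRado.exists_tendsto_radoProb hA hPR (hℓ.trans_eq hf.symm) hr
    exact ⟨c, hc, fun p hp => htendsto p (hp.mono fun _ => le_of_lt)⟩
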